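/- Let $(R,\mathfrak m)$ be a Noetherian local ring of Krull dimension $3$ which is a hypersurface, i.e. its completion satisfies $\hat R\cong T/(f)$ for some regular local ring $T$ and some $f\in T$. Let $U_R=\operatorname{Spec} R\setminus\{\mathfrak m\}$ be the punctured spectrum. Let $M$ be a maximal Cohen-Macaulay $R$-module (finitely generated with $\operatorname{depth} M=\dim R$) that is locally free on $U_R$, and let $N$ be any finitely generated $R$-module. Write $M^*=\operatorname{Hom}_R(M,R)$, and let $$\theta^R(M^*,N)=\ell\big(\operatorname{Tor}^R_{2e+2}(M^*,N)\big)-\ell\big(\operatorname{Tor}^R_{2e+1}(M^*,N)\big),$$ where $\ell$ denotes length and $e$ is any integer with $2e\ge\dim R$ (the lengths are finite and the value does not depend on $e$). Suppose that $\theta^R(M^*,N)=0$. If $\operatorname{Ext}^1_R(M,N)=0$, then $M$ is free or $\operatorname{pd}_R N<\infty$. -/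

import Mathlib

universe u v

open CategoryTheory

/-- The depth of a finitely generated module `M` over a Noetherian local ring `R`: the supremum of
the lengths of the `M`-regular sequences in the maximal ideal. (When `M` is finitely generated and
nonzero, a weakly regular sequence in the maximal ideal is regular by Nakayama's lemma; the zero
module gets depth `∞`, as usual.) -/
noncomputable def moduleDepth (R : Type u) [CommRing R] [IsLocalRing R]
    (M : Type v) [AddCommGroup M] [Module R M] : ℕ∞ :=
  ⨆ (rs : List R) (_ : ∀ r ∈ rs, r ∈ IsLocalRing.maximalIdeal R)
    (_ : RingTheory.Sequence.IsWeaklyRegular M rs), (rs.length : ℕ∞)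

/-- `M` is a maximal Cohen-Macaulay `R`-module: it is finitely generated and
`depth M = dim R`. In particular the zero module is not maximal Cohen-Macaulay. -/
structure IsMaximalCohenMacaulay (R : Type u) [CommRing R] [IsLocalRing R]
    (M : Type v) [AddCommGroup M] [Module R M] : Prop where
  finite : Module.Finite R M
  depth_eq : (moduleDepth R M : WithBot ℕ∞) = ringKrullDim R

/-- A Noetherian local ring `R` is a (local) hypersurface if its completion is isomorphic to
`T / (f)` for a regular local ring `T` and an element `f` of `T`. (Requiring `T` to be complete
gives the same notion: replace `T` by its completion.) -/
def IsLocalHypersurface (R : Type u) [CommRing R] [IsLocalRing R] [IsNoetherianRing R] : Prop :=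
  ∃ (T : Type u) (_ : CommRing T) (_ : IsRegularLocalRing T) (f : T),
    Nonempty (AdicCompletion (IsLocalRing.maximalIdeal R) R ≃+* T ⧸ Ideal.span {f})

/-- The punctured spectrum `U_R = Spec R \ {𝔪}` of a local ring. -/
def puncturedSpectrum (R : Type u) [CommRing R] [IsLocalRing R] : Set (PrimeSpectrum R) :=
  {IsLocalRing.closedPoint R}ᶜ

/-- `M` is locally free on the punctured spectrum: `M_p` is a free `R_p`-module for every prime
`p` other than the maximal ideal. -/
def IsLocallyFreeOnPuncturedSpectrum (R : Type u) [CommRing R] [IsLocalRing R]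
    (M : Type v) [AddCommGroup M] [Module R M] : Prop :=
  ∀ p ∈ puncturedSpectrum R,
    Module.Free (Localization.AtPrime p.asIdeal) (LocalizedModule p.asIdeal.primeCompl M)

/-- The module `Tor_i^R(M, N)`, computed from a projective resolution of `M`. -/
noncomputable abbrev torModule (R : Type u) [CommRing R] (M N : Type u)
    [AddCommGroup M] [Module R M] [AddCommGroup N] [Module R N] (i : ℕ) : ModuleCat.{u} R :=
  ((Tor' (ModuleCat.{u} R) i).obj (ModuleCat.of R M)).obj (ModuleCat.of R N)

/-- Hochster's theta function `ℓ(Tor_{2e+2}^R(M, N)) - ℓ(Tor_{2e+1}^R(M, N))`, computed at `e`.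
It is used for `2e ≥ dim R` over a local hypersurface, with `M` locally free on the punctured
spectrum and `M`, `N` finitely generated; then both lengths are finite and the value does not
depend on `e`. -/
noncomputable def hochsterTheta (R : Type u) [CommRing R] (M N : Type u)
    [AddCommGroup M] [Module R M] [AddCommGroup N] [Module R N] (e : ℕ) : ℤ :=
  ((Module.length R (torModule R M N (2 * e + 2))).toNat : ℤ) -
    ((Module.length R (torModule R M N (2 * e + 1))).toNat : ℤ)

/-! ### Projective dimension along short exact sequences -/

section ProjectiveDimension

variable {A : Type u} [CommRing A]

/-! Pass to the completion `S = T/(f)`, which is faithfully flat over `R`. If `f = 0`, then `S` is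
regular and `N` has finite projective dimension. Otherwise the completion of `M` has depth at least
`dim T - 1`, hence projective dimension at most 1 over `T`, and it is the cokernel of a minimal
matrix factorization `(A, B)` of `f`. Its dual is the image of `Bᵀ` over `S`, so `Tor(M*, N)` is the
homology of the 2-periodic complex given by `Aᵀ` and `Bᵀ` on powers of the completion of `N`.
Vanishing of `Ext¹(M, N)` is exactness at one of the two spots and kills the even Tor; `θ = 0` then
kills the odd Tor, so the complex is exact.

It remains to see that exactness forces `B` to be invertible (so `M` is free) or `pd N < ∞`:
`exists_hasProjectiveDimensionLE_of_actExact`. Exactness passes to syzygies of `N` over `S`, so `N`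
may be assumed to have projective dimension at most 1 over `T`, with its own minimal factorization.
The tensor product of the two factorizations is an honest 2-periodic complex of free `T`-modules,
since the two copies of `f` cancel. It is exact, and finite global dimension of `T` makes its images
projective, so it stays exact modulo the maximal ideal. If both second factors were singular there,
the product of two kernel vectors would be a cycle that is not a boundary:
`isUnit_det_or_isUnit_det`. -/

lemma ModuleCat.hasProjectiveDimensionLE_zero_iff (X : Type u) [AddCommGroup X] [Module A X] :
    HasProjectiveDimensionLE (ModuleCat.of A X) 0 ↔ Module.Projective A X := by
  rw [← projective_iff_hasProjectiveDimensionLE_zero, ← IsProjective.iff_projective]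

/-- The short exact sequence in `ModuleCat` attached to an exact pair of linear maps. -/
lemma ModuleCat.exists_shortExact {K F X : Type u} [AddCommGroup K] [Module A K] [AddCommGroup F]
    [Module A F] [AddCommGroup X] [Module A X] {i : K →ₗ[A] F} {p : F →ₗ[A] X}
    (hi : Function.Injective i) (hip : Function.Exact i p) (hp : Function.Surjective p) :
    ∃ w, (ShortComplex.mk (ModuleCat.ofHom i) (ModuleCat.ofHom p) w).ShortExact := by
  have w : ModuleCat.ofHom i ≫ ModuleCat.ofHom p = 0 := by
    rw [← ModuleCat.ofHom_comp, hip.linearMap_comp_eq_zero]; rfl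
  exact ⟨w, { exact := (ShortComplex.ShortExact.moduleCat_exact_iff_function_exact _).2 hip
              mono_f := (ModuleCat.mono_iff_injective _).2 hi
              epi_g := (ModuleCat.epi_iff_surjective _).2 hp }⟩

lemma ModuleCat.hasProjectiveDimensionLE_succ_iff {K F X : Type u} [AddCommGroup K] [Module A K]
    [AddCommGroup F] [Module A F] [AddCommGroup X] [Module A X] [Module.Projective A F]
    {i : K →ₗ[A] F} {p : F →ₗ[A] X}
    (hi : Function.Injective i) (hip : Function.Exact i p) (hp : Function.Surjective p) (n : ℕ) :
    HasProjectiveDimensionLE (ModuleCat.of A X) (n + 1) ↔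
      HasProjectiveDimensionLE (ModuleCat.of A K) n := by
  obtain ⟨w, h⟩ := ModuleCat.exists_shortExact hi hip hp
  exact h.hasProjectiveDimensionLT_X₃_iff n ((IsProjective.iff_projective _).1 ‹_›)

end ProjectiveDimension

/-! ### Regular local rings are domains of finite global dimension -/

section Regular

open IsLocalRing Pointwise

/-- Modulo a regular element of the maximal ideal projective dimension does not drop. -/
lemma ModuleCat.hasProjectiveDimensionLE_of_quotSMulTop {T : Type u} [CommRing T] [IsLocalRing T]
    [IsNoetherianRing T] {x : T} (hx : x ∈ maximalIdeal T) (hreg : IsSMulRegular T x) (n : ℕ)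
    (X : Type u) [AddCommGroup X] [Module T X] [Module.Finite T X] (hX : IsSMulRegular X x)
    (h : HasProjectiveDimensionLE (ModuleCat.of (T ⧸ Ideal.span {x}) (QuotSMulTop x X)) n) :
    HasProjectiveDimensionLE (ModuleCat.of T X) n := by
  have hnt : Nontrivial (T ⧸ Ideal.span {x}) := by
    refine Ideal.Quotient.nontrivial_iff.2 ?_
    rw [Ne, Ideal.span_singleton_eq_top]
    exact hx
  have : IsLocalRing (T ⧸ Ideal.span {x}) :=
    IsLocalRing.of_surjective' (Ideal.Quotient.mk _) Ideal.Quotient.mk_surjective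
  induction n generalizing X with
  | zero =>
    rw [ModuleCat.hasProjectiveDimensionLE_zero_iff] at h ⊢
    have : Module.Finite (T ⧸ Ideal.span {x}) (QuotSMulTop x X) :=
      Module.Finite.of_restrictScalars_finite T _ _
    have : Module.Free (T ⧸ Ideal.span {x}) (QuotSMulTop x X) :=
      Module.free_of_flat_of_isLocalRing
    have : Module.FinitePresentation T X := Module.finitePresentation_of_finite T X
    have : Module.Free T X := (Module.free_quotSMulTop_iff_free T X
      (by rw [IsLocalRing.jacobson_eq_maximalIdeal _ bot_ne_top]; exact hx) hX).1 inferInstance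
    infer_instance
  | succ n ih =>
    obtain ⟨k, p, hp⟩ := Module.Finite.exists_fin' T X
    have hex : Function.Exact (LinearMap.ker p).subtype p := LinearMap.exact_subtype_ker_map p
    have hF : IsSMulRegular (Fin k → T) x := fun a b hab => by
      ext i; exact hreg (congrFun hab i)
    rw [ModuleCat.hasProjectiveDimensionLE_succ_iff (Submodule.injective_subtype _) hex hp]
    have hK : IsSMulRegular (LinearMap.ker p) x := hF.submodule _ _
    refine ih _ hK ?_
    -- As `x` is regular on `X`, the syzygy sequence stays exact modulo `x`.
    have e1 : Function.Exact (QuotSMulTop.map x (LinearMap.ker p).subtype) (QuotSMulTop.map x p) :=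
      QuotSMulTop.map_exact x hex hp
    have i1 : Function.Injective (QuotSMulTop.map x (LinearMap.ker p).subtype) := by
      rw [injective_iff_map_eq_zero]
      intro z hz
      obtain ⟨z, rfl⟩ := Submodule.mkQ_surjective _ z
      have hz' : (z : Fin k → T) ∈ x • (⊤ : Submodule T (Fin k → T)) :=
        (Submodule.Quotient.mk_eq_zero _).1 hz
      obtain ⟨w, -, hw⟩ := (Submodule.mem_smul_pointwise_iff_exists _ _ _).1 hz'
      have hpw : p w = 0 := hX (by
        simp only [smul_zero]; rw [← map_smul, hw]; exact z.2)
      refine (Submodule.Quotient.mk_eq_zero _).2 ?_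
      exact (Submodule.mem_smul_pointwise_iff_exists _ _ _).2
        ⟨⟨w, hpw⟩, trivial, Subtype.ext hw⟩
    have s1 : Function.Surjective (QuotSMulTop.map x p) := QuotSMulTop.map_surjective x hp
    have : Module.Projective (T ⧸ Ideal.span {x}) (QuotSMulTop x (Fin k → T)) := inferInstance
    exact (ModuleCat.hasProjectiveDimensionLE_succ_iff
      (i := (QuotSMulTop.map x (LinearMap.ker p).subtype).extendScalarsOfSurjective
        Ideal.Quotient.mk_surjective)
      (p := (QuotSMulTop.map x p).extendScalarsOfSurjective Ideal.Quotient.mk_surjective)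
      i1 e1 s1 n).1 h


namespace IsRegularLocalRing

/-- The class of `x` in the cotangent space is nonzero, so killing it lowers the number of
generators of the maximal ideal to `d`, while the Krull dimension drops by at most one. -/
lemma mk_mem_quotient_regular {T : Type u} [CommRing T] [IsRegularLocalRing T] {d : ℕ}
    (hd : ringKrullDim T = (d + 1 : ℕ)) {x : T} (hx : x ∈ maximalIdeal T)
    (hx2 : x ∉ maximalIdeal T ^ 2) :
    IsRegularLocalRing (T ⧸ Ideal.span {x}) ∧ ringKrullDim (T ⧸ Ideal.span {x}) = d := by
  have hnt : Nontrivial (T ⧸ Ideal.span {x}) := by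
    refine Ideal.Quotient.nontrivial_iff.2 ?_
    rw [Ne, Ideal.span_singleton_eq_top]
    exact hx
  have hloc : IsLocalRing (T ⧸ Ideal.span {x}) :=
    IsLocalRing.of_surjective' (Ideal.Quotient.mk _) Ideal.Quotient.mk_surjective
  have hV : Module.finrank (ResidueField T) (CotangentSpace T) = d + 1 := by
    have := (iff_finrank_cotangentSpace T).1 ‹_›
    rw [hd] at this
    exact_mod_cast this
  set xb : CotangentSpace T := (maximalIdeal T).toCotangent ⟨x, hx⟩ with hxb
  have hxb0 : xb ≠ 0 := by
    rw [Ne, Ideal.toCotangent_eq_zero]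
    exact hx2
  have hW : Module.finrank (ResidueField T) (CotangentSpace T ⧸ Submodule.span (ResidueField T) {xb})
      = d := by
    have := Submodule.finrank_quotient_add_finrank (Submodule.span (ResidueField T) {xb})
    rw [finrank_span_singleton hxb0, hV] at this
    omega
  let b := Module.finBasisOfFinrankEq _ _ hW
  have hsurj : Function.Surjective
      (fun y : maximalIdeal T =>
        (Submodule.span (ResidueField T) {xb}).mkQ ((maximalIdeal T).toCotangent y)) :=
    (Submodule.mkQ_surjective _).comp (Ideal.toCotangent_surjective _)
  choose y hy using fun i => hsurj (b i)
  have hle : maximalIdeal T ≤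
      Ideal.span ({x} ∪ Set.range fun i => (y i : T)) ⊔ maximalIdeal T • maximalIdeal T := by
    intro z hz
    have h1 := b.sum_repr ((Submodule.span (ResidueField T) {xb}).mkQ
      ((maximalIdeal T).toCotangent ⟨z, hz⟩))
    choose c hc using fun i => residue_surjective (R := T) (b.repr
      ((Submodule.span (ResidueField T) {xb}).mkQ ((maximalIdeal T).toCotangent ⟨z, hz⟩)) i)
    have h2 : (maximalIdeal T).toCotangent (⟨z, hz⟩ - ∑ i, c i • y i) ∈
        Submodule.span (ResidueField T) {xb} := by
      rw [← Submodule.ker_mkQ (Submodule.span (ResidueField T) {xb}), LinearMap.mem_ker, map_sub,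
        map_sub, ← h1, sub_eq_zero, map_sum, map_sum]
      refine Finset.sum_congr rfl fun i _ => ?_
      rw [← hc i, ← hy i, map_smul, ← algebraMap_smul (ResidueField T) (c i)
        ((maximalIdeal T).toCotangent (y i)), map_smul]
      rfl
    obtain ⟨a, ha⟩ := Submodule.mem_span_singleton.1 h2
    obtain ⟨a, rfl⟩ := residue_surjective a
    have h3 : (maximalIdeal T).toCotangent (⟨z, hz⟩ - ∑ i, c i • y i - a • ⟨x, hx⟩) = 0 := by
      rw [map_sub, ← ha, map_smul, sub_eq_zero, hxb, ← algebraMap_smul (ResidueField T) a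
        ((maximalIdeal T).toCotangent ⟨x, hx⟩)]
      rfl
    rw [Ideal.toCotangent_eq_zero] at h3
    have h4 : z = (∑ i, c i * y i + a * x) + (z - ∑ i, c i * y i - a * x) := by ring
    rw [h4]
    refine Submodule.add_mem_sup (add_mem (sum_mem fun i _ => ?_) ?_) ?_
    · exact Ideal.mul_mem_left _ _ (Ideal.subset_span (Or.inr ⟨i, rfl⟩))
    · exact Ideal.mul_mem_left _ _ (Ideal.subset_span (Or.inl rfl))
    · rw [smul_eq_mul, ← pow_two]
      simpa using h3
  have hle' : maximalIdeal T ≤ Ideal.span ({x} ∪ Set.range fun i => (y i : T)) :=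
    Submodule.le_of_le_smul_of_le_jacobson_bot (IsNoetherian.noetherian _)
      (by rw [IsLocalRing.jacobson_eq_maximalIdeal _ bot_ne_top]) hle
  have hmax : maximalIdeal (T ⧸ Ideal.span {x}) =
      Ideal.span (Set.range fun i => Ideal.Quotient.mk (Ideal.span {x}) (y i : T)) := by
    refine le_antisymm ?_ ?_
    · intro z hz
      obtain ⟨z, rfl⟩ := Ideal.Quotient.mk_surjective z
      have hz' : z ∈ maximalIdeal T := by
        by_contra hu
        exact hz ((not_not.1 ((mem_maximalIdeal z).not.1 hu)).map _)
      have := Ideal.mem_map_of_mem (Ideal.Quotient.mk (Ideal.span {x})) (hle' hz')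
      rw [Ideal.map_span, Set.image_union, Ideal.span_union, ← Set.range_comp] at this
      simpa [Function.comp_def] using! this
    · rw [Ideal.span_le]
      rintro _ ⟨i, rfl⟩
      intro hu
      have : IsLocalHom (Ideal.Quotient.mk (Ideal.span {x})) :=
        .of_surjective _ Ideal.Quotient.mk_surjective
      exact (y i).2 (isUnit_of_map_unit (Ideal.Quotient.mk (Ideal.span {x})) _ hu)
  have hrank : (maximalIdeal (T ⧸ Ideal.span {x})).spanFinrank ≤ d := by
    rw [hmax]
    refine (Submodule.spanFinrank_span_le_ncard_of_finite (Set.finite_range _)).trans ?_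
    rw [← Set.image_univ]
    refine (Set.ncard_image_le Set.finite_univ).trans ?_
    simp [Set.ncard_univ]
  have hdim : (d : WithBot ℕ∞) ≤ ringKrullDim (T ⧸ Ideal.span {x}) := by
    have := ringKrullDim_le_ringKrullDim_quotient_add_encard (R := T) {x} (by
      rw [Set.singleton_subset_iff, IsLocalRing.ringJacobson_eq_maximalIdeal]; exact hx)
    rw [hd] at this
    simp only [Set.encard_singleton] at this
    push_cast at this
    exact ENat.WithBot.add_le_add_one_right_iff.1 this
  have hreg : IsRegularLocalRing (T ⧸ Ideal.span {x}) :=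
    of_spanFinrank_maximalIdeal_le _ (le_trans (by exact_mod_cast hrank) hdim)
  refine ⟨hreg, le_antisymm ?_ hdim⟩
  exact (ringKrullDim_le_spanFinrank_maximalIdeal _).trans (by exact_mod_cast hrank)

lemma exists_krullDim_eq (T : Type u) [CommRing T] [IsRegularLocalRing T] :
    ∃ d : ℕ, ringKrullDim T = d :=
  ⟨_, spanFinrank_maximalIdeal.symm⟩

lemma maximalIdeal_eq_bot_of_krullDim_eq_zero {T : Type u} [CommRing T] [IsRegularLocalRing T]
    (hd : ringKrullDim T = 0) : maximalIdeal T = ⊥ := by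
  have := spanFinrank_maximalIdeal (R := T)
  rw [hd] at this
  exact (Submodule.spanFinrank_eq_zero_iff_eq_bot (IsNoetherian.noetherian _)).1
    (by exact_mod_cast this)

/-- Prime avoidance, which tolerates the nonprime ideal `𝔪²`. In positive dimension `𝔪` lies neither
in `𝔪²` nor in a minimal prime. -/
lemma exists_mem_maximalIdeal_notMem {T : Type u} [CommRing T] [IsRegularLocalRing T] {d : ℕ}
    (hd : ringKrullDim T = (d + 1 : ℕ)) :
    ∃ x ∈ maximalIdeal T, x ∉ maximalIdeal T ^ 2 ∧ ∀ p ∈ minimalPrimes T, x ∉ p := by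
  classical
  by_contra! hcon
  have hfin : (minimalPrimes T).Finite := minimalPrimes.finite_of_isNoetherianRing T
  have hsub : (maximalIdeal T : Set T) ⊆
      ⋃ I ∈ (↑(insert (maximalIdeal T ^ 2) hfin.toFinset) : Set (Ideal T)), (I : Set T) := by
    intro x hx
    by_cases hx2 : x ∈ maximalIdeal T ^ 2
    · exact Set.mem_biUnion (x := maximalIdeal T ^ 2) (by simp) hx2
    · obtain ⟨p, hp, hxp⟩ := hcon x hx hx2
      exact Set.mem_biUnion (x := p) (by simp [hp]) hxp
  rw [Ideal.subset_union_prime (maximalIdeal T ^ 2) (maximalIdeal T ^ 2)] at hsub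
  · obtain ⟨I, hI, hle⟩ := hsub
    have hd0 : ringKrullDim T ≠ 0 := by
      rw [hd]; exact_mod_cast Nat.succ_ne_zero d
    rcases Finset.mem_insert.1 hI with rfl | hI
    · exact (maximalIdeal_sq_lt_of_ringKrullDim_ne_zero hd0).not_ge hle
    · have hI : I ∈ minimalPrimes T := by simpa using hI
      have hIp : I.IsPrime := hI.1.1
      have hIe : I = maximalIdeal T := le_antisymm (le_maximalIdeal hIp.ne_top) hle
      apply hd0
      rw [← maximalIdeal_height_eq_ringKrullDim, ← hIe, Ideal.height_eq_zero_iff.2 hI]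
      rfl
  · intro i hi h1 h2
    have := (Finset.mem_insert.1 hi).resolve_left h1
    have : i ∈ minimalPrimes T := by simpa using this
    exact this.1.1

/-- By induction `T/(x)` is a domain, so `(x)` is prime and contains a minimal prime `p`. As `x ∉
p`, one gets `p = xp`, and Nakayama gives `p = 0`. -/
lemma isDomain_aux (d : ℕ) : ∀ (T : Type u) [CommRing T] [IsRegularLocalRing T],
    ringKrullDim T = d → IsDomain T := by
  induction d with
  | zero =>
    intro T _ _ hd
    have := (IsLocalRing.isField_iff_maximalIdeal_eq).2
      (maximalIdeal_eq_bot_of_krullDim_eq_zero (T := T) (by simpa using hd))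
    exact this.isDomain
  | succ d ih =>
    intro T _ _ hd
    obtain ⟨x, hx, hx2, hxp⟩ := exists_mem_maximalIdeal_notMem hd
    obtain ⟨hreg, hdim⟩ := mk_mem_quotient_regular hd hx hx2
    have := ih _ hdim
    have hprime : (Ideal.span {x}).IsPrime := (Ideal.Quotient.isDomain_iff_prime _).1 this
    obtain ⟨p, hp, hpx⟩ := Ideal.exists_minimalPrimes_le (I := ⊥) (J := Ideal.span {x}) bot_le
    have hpp : p.IsPrime := hp.1.1
    have hp0 : p = ⊥ := by
      refine Submodule.eq_bot_of_le_smul_of_le_jacobson_bot (maximalIdeal T) p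
        (IsNoetherian.noetherian _) (fun y hy => ?_)
        (by rw [IsLocalRing.jacobson_eq_maximalIdeal _ bot_ne_top])
      obtain ⟨a, rfl⟩ := Ideal.mem_span_singleton'.1 (hpx hy)
      rw [mul_comm]
      exact Submodule.smul_mem_smul hx ((hpp.mem_or_mem hy).resolve_right (hxp p hp))
    subst hp0
    exact IsDomain.of_bot_isPrime T

theorem isDomain (T : Type u) [CommRing T] [IsRegularLocalRing T] : IsDomain T :=
  let ⟨d, hd⟩ := exists_krullDim_eq T
  isDomain_aux d T hd

/-- Finitely generated modules over a regular local ring have projective dimension at most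
the Krull dimension of the ring. -/
theorem hasProjectiveDimensionLE (d : ℕ) : ∀ (T : Type u) [CommRing T] [IsRegularLocalRing T],
    ringKrullDim T = d → ∀ (X : Type u) [AddCommGroup X] [Module T X] [Module.Finite T X],
    HasProjectiveDimensionLE (ModuleCat.of T X) d := by
  induction d with
  | zero =>
    intro T _ _ hd X _ _ _
    have := (IsLocalRing.isField_iff_maximalIdeal_eq).2
      (maximalIdeal_eq_bot_of_krullDim_eq_zero (T := T) (by simpa using hd))
    let := this.toField
    rw [Nat.cast_zero] at hd
    rw [ModuleCat.hasProjectiveDimensionLE_zero_iff]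
    have : Module.Free T X := Module.Free.of_divisionRing T X
    infer_instance
  | succ d ih =>
    intro T _ _ hd X _ _ _
    obtain ⟨x, hx, hx2, hxp⟩ := exists_mem_maximalIdeal_notMem hd
    obtain ⟨hreg, hdim⟩ := mk_mem_quotient_regular hd hx hx2
    have := isDomain T
    have hx0 : x ≠ 0 := by rintro rfl; exact hx2 (zero_mem _)
    have hxr : IsSMulRegular T x := fun a b hab => mul_left_cancel₀ hx0 hab
    -- `x` need not be regular on `X`, but it is on the first syzygy, a submodule of a free module.
    obtain ⟨k, p, hp⟩ := Module.Finite.exists_fin' T X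
    rw [ModuleCat.hasProjectiveDimensionLE_succ_iff (Submodule.injective_subtype _)
      (LinearMap.exact_subtype_ker_map p) hp]
    have hF : IsSMulRegular (Fin k → T) x := fun a b hab => by
      ext i; exact hxr (congrFun hab i)
    refine ModuleCat.hasProjectiveDimensionLE_of_quotSMulTop hx hxr d _ (hF.submodule _ _) ?_
    have : Module.Finite (T ⧸ Ideal.span {x}) (QuotSMulTop x (LinearMap.ker p)) :=
      Module.Finite.of_restrictScalars_finite T _ _
    exact ih _ hdim _

end IsRegularLocalRing

end Regular

/-! ### Splicing a resolution onto a short exact sequence -/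

section Splice

namespace CategoryTheory.ProjectiveResolution

variable {C : Type u} [Category.{v} C] [Abelian C]

open Limits

/-- The augmentation map of a projective resolution. -/
noncomputable def augmentation {K : C} (Q : ProjectiveResolution K) : Q.complex.X 0 ⟶ K := Q.π.f 0

lemma d_comp_augmentation {K : C} (Q : ProjectiveResolution K) :
    Q.complex.d 1 0 ≫ Q.augmentation = 0 := Q.complex_d_comp_π_f_zero

lemma epi_augmentation {K : C} (Q : ProjectiveResolution K) : Epi Q.augmentation :=
  inferInstanceAs (Epi (Q.π.f 0))

lemma exact_augmentation {K : C} (Q : ProjectiveResolution K) :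
    (ShortComplex.mk (Q.complex.d 1 0) Q.augmentation Q.d_comp_augmentation).Exact := Q.exact₀

lemma d_comp_augmentation_comp {K F : C} (Q : ProjectiveResolution K) (i : K ⟶ F) :
    Q.complex.d 1 0 ≫ Q.augmentation ≫ i = 0 := by
  rw [← Category.assoc, Q.d_comp_augmentation, zero_comp]

lemma augmentation_comp_comp {S : ShortComplex C} (Q : ProjectiveResolution S.X₁) :
    (Q.augmentation ≫ S.f) ≫ S.g = 0 := by
  rw [Category.assoc, S.zero, comp_zero]

/-- A projective resolution of the first term of a short exact sequence with projective middle
term extends to a projective resolution of the last term. -/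
noncomputable def splice {S : ShortComplex C} (hS : S.ShortExact) [Projective S.X₂]
    (Q : ProjectiveResolution S.X₁) : ProjectiveResolution S.X₃ where
  complex := Q.complex.augment (Q.augmentation ≫ S.f) (Q.d_comp_augmentation_comp S.f)
  projective n := by
    rcases n with _ | n
    · assumption
    · exact Q.projective n
  π := (ChainComplex.toSingle₀Equiv _ _).symm ⟨S.g, Q.augmentation_comp_comp⟩
  quasiIso := ⟨fun n => by
    have := hS.mono_f
    have := hS.epi_g
    rcases n with _ | n
    · rw [ChainComplex.quasiIsoAt₀_iff, ShortComplex.quasiIso_iff_of_zeros']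
      · have hex : (ShortComplex.mk (Q.augmentation ≫ S.f) S.g Q.augmentation_comp_comp).Exact := by
          let φ : ShortComplex.mk (Q.augmentation ≫ S.f) S.g Q.augmentation_comp_comp ⟶ S :=
            { τ₁ := Q.augmentation, τ₂ := 𝟙 S.X₂, τ₃ := 𝟙 S.X₃ }
          have h1 : Epi φ.τ₁ := Q.epi_augmentation
          have h2 : IsIso φ.τ₂ := inferInstanceAs (IsIso (𝟙 S.X₂))
          have h3 : Mono φ.τ₃ := inferInstanceAs (Mono (𝟙 S.X₃))
          rw [ShortComplex.exact_iff_of_epi_of_isIso_of_mono φ]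
          exact hS.exact
        have hπ := ChainComplex.toSingle₀Equiv_symm_apply_f_zero
          (C := Q.complex.augment (Q.augmentation ≫ S.f) (Q.d_comp_augmentation_comp S.f))
          S.g Q.augmentation_comp_comp
        refine (ShortComplex.exact_and_epi_g_iff_of_iso ?_).2 ⟨hex, by assumption⟩
        exact ShortComplex.isoMk (Iso.refl _) (Iso.refl _) (Iso.refl _)
          ((Category.id_comp _).trans (Category.comp_id _).symm)
          ((Category.id_comp S.g).trans (hπ.symm.trans (Category.comp_id _).symm))
      all_goals rfl
    · rw [quasiIsoAt_iff_exactAt']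
      · rw [HomologicalComplex.exactAt_iff' _ (n + 2) (n + 1) n (by simp) (by simp)]
        rcases n with _ | n
        -- At the splice, following the augmentation by the monomorphism `S.f` does not change its
        -- kernel.
        · let φ : ShortComplex.mk (Q.complex.d 1 0) Q.augmentation Q.d_comp_augmentation ⟶
              ShortComplex.mk (Q.complex.d 1 0) (Q.augmentation ≫ S.f)
                (Q.d_comp_augmentation_comp S.f) :=
            { τ₁ := 𝟙 (Q.complex.X 1), τ₂ := 𝟙 (Q.complex.X 0), τ₃ := S.f }
          have h1 : Epi φ.τ₁ := inferInstanceAs (Epi (𝟙 (Q.complex.X 1)))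
          have h2 : IsIso φ.τ₂ := inferInstanceAs (IsIso (𝟙 (Q.complex.X 0)))
          have h3 : Mono φ.τ₃ := hS.mono_f
          exact (ShortComplex.exact_iff_of_epi_of_isIso_of_mono φ).1 Q.exact_augmentation
        · exact Q.exact_succ n
      · apply ChainComplex.exactAt_succ_single_obj⟩

end CategoryTheory.ProjectiveResolution

end Splice

/-! ### Dimension shifting and `Tor₁` -/

section Tor

open Limits TensorProduct

namespace CategoryTheory

variable {C : Type u} [Category.{v} C] [Abelian C] [HasProjectiveResolutions C]
  {D : Type*} [Category* D] [Abelian D]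

/-- Dimension shifting for left derived functors. -/
noncomputable def Functor.leftDerivedShift (F : C ⥤ D) [F.Additive] {S : ShortComplex C}
    (hS : S.ShortExact) [Projective S.X₂] (n : ℕ) :
    (F.leftDerived (n + 2)).obj S.X₃ ≅ (F.leftDerived (n + 1)).obj S.X₁ :=
  let Q := projectiveResolution S.X₁
  (Q.splice hS).isoLeftDerivedObj F (n + 2) ≪≫
    ShortComplex.homologyMapIso ((HomologicalComplex.isoSc' _ (n + 3) (n + 2) (n + 1)
      (by simp) (by simp)) ≪≫
      (ShortComplex.isoMk (Iso.refl _) (Iso.refl _) (Iso.refl _)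
        ((Category.id_comp _).trans (Category.comp_id _).symm)
        ((Category.id_comp _).trans (Category.comp_id _).symm) :
        ((F.mapHomologicalComplex _).obj (Q.splice hS).complex).sc' (n + 3) (n + 2) (n + 1) ≅
        ((F.mapHomologicalComplex _).obj Q.complex).sc' (n + 2) (n + 1) n) ≪≫
      (HomologicalComplex.isoSc' _ (n + 2) (n + 1) n (by simp) (by simp)).symm) ≪≫
    (Q.isoLeftDerivedObj F (n + 1)).symm

end CategoryTheory

variable {A : Type u} [CommRing A]

/-- `Tor_{n+2}(X, N) ≅ Tor_{n+1}(K, N)` for a first syzygy `K` of `X`. -/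
lemma nonempty_torModule_equiv {K F X : Type u} [AddCommGroup K] [Module A K]
    [AddCommGroup F] [Module A F] [AddCommGroup X] [Module A X] [Module.Projective A F]
    {i : K →ₗ[A] F} {p : F →ₗ[A] X}
    (hi : Function.Injective i) (hip : Function.Exact i p) (hp : Function.Surjective p)
    (N : Type u) [AddCommGroup N] [Module A N] (n : ℕ) :
    Nonempty (torModule A X N (n + 2) ≃ₗ[A] torModule A K N (n + 1)) := by
  obtain ⟨w, h⟩ := ModuleCat.exists_shortExact hi hip hp
  have : Projective (ShortComplex.mk (ModuleCat.ofHom i) (ModuleCat.ofHom p) w).X₂ :=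
    (IsProjective.iff_projective _).1 ‹_›
  exact ⟨(Functor.leftDerivedShift
    ((MonoidalCategory.tensoringRight (ModuleCat.{u} A)).obj (ModuleCat.of A N)) h n).toLinearEquiv⟩

/-- The homology of `X₁ → X₂ → X₃` when `X₂ → X₃` factors through the cokernel of `X₁ → X₂`. -/
lemma ModuleCat.nonempty_homology_equiv_ker (S : ShortComplex (ModuleCat.{u} A)) {D : Type u}
    [AddCommGroup D] [Module A D] (p : S.X₂ →ₗ[A] D) (j : D →ₗ[A] S.X₃)
    (hp : Function.Surjective p) (hfp : Function.Exact S.f.hom p) (hg : S.g.hom = j ∘ₗ p) :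
    Nonempty (S.homology ≃ₗ[A] LinearMap.ker j) := by
  refine ⟨S.moduleCatHomologyIso.toLinearEquiv ≪≫ₗ ?_⟩
  let q : LinearMap.ker S.g.hom →ₗ[A] LinearMap.ker j :=
    (p ∘ₗ (LinearMap.ker S.g.hom).subtype).codRestrict _ (fun x =>
      (LinearMap.congr_fun hg x.1).symm.trans x.2)
  have hq : Function.Surjective q := by
    rintro ⟨d, hd⟩
    obtain ⟨x, rfl⟩ := hp d
    exact ⟨⟨x, by rw [LinearMap.mem_ker, hg]; exact hd⟩, rfl⟩
  refine Submodule.quotEquivOfEq _ _ ?_ ≪≫ₗ q.quotKerEquivOfSurjective hq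
  ext x
  rw [LinearMap.mem_ker]
  constructor
  · rintro ⟨y, rfl⟩
    exact Subtype.ext (hfp.apply_apply_eq_zero y)
  · intro h
    obtain ⟨y, hy⟩ := (hfp x.1).1 (congrArg Subtype.val h)
    exact ⟨y, Subtype.ext hy⟩

/-- `Tor_1(X, N)` is the kernel of `K ⊗ N → F ⊗ N` for a first syzygy `K ⊆ F` of `X`. -/
lemma nonempty_torModule_one_equiv {K F X : Type u} [AddCommGroup K] [Module A K]
    [AddCommGroup F] [Module A F] [AddCommGroup X] [Module A X] [Module.Projective A F]
    {i : K →ₗ[A] F} {p : F →ₗ[A] X}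
    (hi : Function.Injective i) (hip : Function.Exact i p) (hp : Function.Surjective p)
    (N : Type u) [AddCommGroup N] [Module A N] :
    Nonempty (torModule A X N 1 ≃ₗ[A] LinearMap.ker (i.rTensor N)) := by
  obtain ⟨w, h⟩ := ModuleCat.exists_shortExact hi hip hp
  have : Projective (ShortComplex.mk (ModuleCat.ofHom i) (ModuleCat.ofHom p) w).X₂ :=
    (IsProjective.iff_projective _).1 ‹_›
  let Q := projectiveResolution (ModuleCat.of A K)
  let G := (MonoidalCategory.tensoringRight (ModuleCat.{u} A)).obj (ModuleCat.of A N)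
  let CC := (G.mapHomologicalComplex (ComplexShape.down ℕ)).obj
    (ProjectiveResolution.splice h Q).complex
  let π₀ := Q.augmentation
  have e1 := ((ProjectiveResolution.splice h Q).isoLeftDerivedObj G 1 ≪≫
    ShortComplex.homologyMapIso (HomologicalComplex.isoSc' CC 2 1 0 (by simp) (by simp)))
  have hex : Function.Exact (Q.complex.d 1 0).hom π₀.hom :=
    (ShortComplex.ShortExact.moduleCat_exact_iff_function_exact _).1 Q.exact_augmentation
  have hs : Function.Surjective π₀.hom :=
    (ModuleCat.epi_iff_surjective π₀).1 Q.epi_augmentation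
  obtain ⟨e2⟩ := ModuleCat.nonempty_homology_equiv_ker (CC.sc' 2 1 0)
    (π₀.hom.rTensor N) (i.rTensor N) (LinearMap.rTensor_surjective N hs)
    (rTensor_exact N hex hs)
    (LinearMap.rTensor_comp N i π₀.hom)
  exact ⟨e1.toLinearEquiv ≪≫ₗ e2⟩

end Tor

/-! ### `Ext¹` as the obstruction to extending maps -/

section Ext

open Abelian

variable {A : Type u} [CommRing A]

/-- `Ext¹(X, N) = 0` iff every map `K → N` extends to `F`, for a first syzygy `K ⊆ F` of `X`. -/
lemma ModuleCat.subsingleton_ext_one_iff {K F X : Type u} [AddCommGroup K] [Module A K]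
    [AddCommGroup F] [Module A F] [AddCommGroup X] [Module A X] [Module.Projective A F]
    {i : K →ₗ[A] F} {p : F →ₗ[A] X}
    (hi : Function.Injective i) (hip : Function.Exact i p) (hp : Function.Surjective p)
    (N : Type u) [AddCommGroup N] [Module A N] :
    Subsingleton (Ext (ModuleCat.of A X) (ModuleCat.of A N) 1) ↔
      ∀ g : K →ₗ[A] N, ∃ h : F →ₗ[A] N, h ∘ₗ i = g := by
  obtain ⟨w, h⟩ := ModuleCat.exists_shortExact hi hip hp
  have : Projective (ModuleCat.of A F) := (IsProjective.iff_projective _).1 ‹_›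
  constructor
  · intro hE g
    obtain ⟨x, hx⟩ := Ext.contravariant_sequence_exact₁ h (ModuleCat.of A N)
      (Ext.mk₀ (ModuleCat.ofHom g)) (n₁ := 1) rfl (Subsingleton.elim _ _)
    obtain ⟨y, rfl⟩ := (Ext.mk₀_bijective _ _).2 x
    refine ⟨y.hom, ?_⟩
    rw [Ext.mk₀_comp_mk₀, (Ext.mk₀_bijective _ _).1.eq_iff] at hx
    exact congrArg ModuleCat.Hom.hom hx
  · intro hext
    refine subsingleton_of_forall_eq 0 fun x => ?_
    obtain ⟨y, rfl⟩ := Ext.contravariant_sequence_exact₃ h (ModuleCat.of A N) x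
      (Ext.eq_zero_of_projective _) (n₀ := 0) rfl
    obtain ⟨y, rfl⟩ := (Ext.mk₀_bijective _ _).2 y
    obtain ⟨z, hz⟩ := hext y.hom
    have : y = ModuleCat.ofHom i ≫ ModuleCat.ofHom z := by
      ext1
      exact hz.symm
    rw [this, ← Ext.mk₀_comp_mk₀]
    exact h.extClass_comp_assoc _

end Ext

/-! ### Matrices acting on powers of a module -/

section MatrixAction

/-- The action of an `n × n` matrix over `A` on `Nⁿ`, for an `A`-module `N`. -/
def Matrix.act {A : Type*} [CommRing A] {n : ℕ} (V : Matrix (Fin n) (Fin n) A) (N : Type*)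
    [AddCommGroup N] [Module A N] : (Fin n → N) →ₗ[A] (Fin n → N) where
  toFun y j := ∑ i, V j i • y i
  map_add' y z := by ext j; simp [Finset.sum_add_distrib]
  map_smul' a y := by ext j; simp [Finset.smul_sum, smul_comm a]

variable {A : Type*} [CommRing A] {n : ℕ} {N : Type*} [AddCommGroup N] [Module A N]

lemma Matrix.act_apply (V : Matrix (Fin n) (Fin n) A) (y : Fin n → N) (j : Fin n) :
    V.act N y j = ∑ i, V j i • y i := rfl

lemma Matrix.act_act (V W : Matrix (Fin n) (Fin n) A) (y : Fin n → N) :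
    V.act N (W.act N y) = (V * W).act N y := by
  ext j
  simp only [Matrix.act_apply, Matrix.mul_apply, Finset.smul_sum, Finset.sum_smul, mul_smul]
  rw [Finset.sum_comm]

lemma Matrix.act_smul_one (a : A) (y : Fin n → N) :
    (a • (1 : Matrix (Fin n) (Fin n) A)).act N y = a • y := by
  ext j
  simp [Matrix.act_apply, Matrix.one_apply]

lemma Matrix.act_comp {N' : Type*} [AddCommGroup N'] [Module A N'] (g : N →ₗ[A] N')
    (V : Matrix (Fin n) (Fin n) A) (y : Fin n → N) :
    V.act N' (fun i => g (y i)) = fun i => g (V.act N y i) := by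
  ext j
  simp [Matrix.act_apply]

lemma Matrix.act_map {B : Type*} [CommRing B] [Algebra A B] [Module B N] [IsScalarTower A B N]
    (V : Matrix (Fin n) (Fin n) A) (y : Fin n → N) :
    (V.map (algebraMap A B)).act N y = V.act N y := by
  ext j
  simp [Matrix.act_apply]

/-- The elements of `Nⁿ` annihilated by `D` lie in the image of `C`. -/
def Matrix.ActExact (C D : Matrix (Fin n) (Fin n) A) (N : Type*) [AddCommGroup N] [Module A N] :
    Prop :=
  ∀ y : Fin n → N, D.act N y = 0 → ∃ z, C.act N z = y

lemma Matrix.actExact_map_iff {B : Type*} [CommRing B] [Algebra A B] [Module B N]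
    [IsScalarTower A B N] (C D : Matrix (Fin n) (Fin n) A) :
    (C.map (algebraMap A B)).ActExact (D.map (algebraMap A B)) N ↔ C.ActExact D N := by
  simp only [Matrix.ActExact, Matrix.act_map]

end MatrixAction

/-! ### Two-periodic exact complexes -/

section Periodic

open IsLocalRing

variable {T : Type u} [CommRing T]

/-- In a `2`-periodic exact complex with projective terms, images of finite projective dimension
are projective. -/
lemma projective_range_of_periodic (d : ℕ) {E : Type u} [AddCommGroup E] [Module T E]
    [Module.Projective T E] (δ δ' : E →ₗ[T] E) (h : Function.Exact δ' δ) (h' : Function.Exact δ δ')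
    (hd : HasProjectiveDimensionLE (ModuleCat.of T (LinearMap.range δ)) d) :
    Module.Projective T (LinearMap.range δ) := by
  induction d generalizing δ δ' with
  | zero => exact (ModuleCat.hasProjectiveDimensionLE_zero_iff _).1 hd
  | succ d ih =>
    have hex : ∀ δ δ' : E →ₗ[T] E, Function.Exact δ' δ →
        Function.Exact (LinearMap.range δ').subtype δ.rangeRestrict := by
      intro δ δ' h x
      rw [← LinearMap.mem_ker, LinearMap.ker_rangeRestrict, LinearMap.mem_ker, h x]
      simp
    -- The image of `δ'` is a syzygy of the image of `δ`, so induction applies with the roles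
    -- swapped. Then `δ'` splits, and its kernel, the image of `δ`, is a direct summand of `E`.
    have h1 : Module.Projective T (LinearMap.range δ') :=
      ih δ' δ h' h ((ModuleCat.hasProjectiveDimensionLE_succ_iff (Submodule.injective_subtype _)
        (hex δ δ' h) δ.surjective_rangeRestrict d).1 hd)
    obtain ⟨s, hs⟩ := Module.projective_lifting_property δ'.rangeRestrict LinearMap.id
      δ'.surjective_rangeRestrict
    have hs' : ∀ x, δ' (s x) = x := fun x => congrArg Subtype.val (LinearMap.congr_fun hs x)
    let r : E →ₗ[T] LinearMap.range δ :=
      (LinearMap.id - s ∘ₗ δ'.rangeRestrict).codRestrict _ (fun x => by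
        rw [LinearMap.mem_range]
        exact (h' _).1 (by
          rw [LinearMap.sub_apply, map_sub, LinearMap.comp_apply, hs']
          simp))
    refine Module.Projective.of_split (LinearMap.range δ).subtype r ?_
    ext x
    have hx : δ' x = 0 := (h' _).2 x.2
    have : δ'.rangeRestrict (x : E) = 0 := Subtype.ext hx
    simp [r, this]

/-- In a `2`-periodic exact complex with projective images, cycles modulo an ideal lift. -/
lemma exists_mem_smul_top_of_periodic {E : Type u} [AddCommGroup E] [Module T E]
    (I : Ideal T) (δ δ' : E →ₗ[T] E) (h : Function.Exact δ' δ)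
    (hP : Module.Projective T (LinearMap.range δ)) {w : E}
    (hw : δ' w ∈ I • (⊤ : Submodule T E)) :
    ∃ w' ∈ I • (⊤ : Submodule T E), δ' (w - w') = 0 := by
  obtain ⟨s, hs⟩ := Module.projective_lifting_property δ.rangeRestrict LinearMap.id
    δ.surjective_rangeRestrict
  have hs' : ∀ x, δ (s x) = x := fun x => congrArg Subtype.val (LinearMap.congr_fun hs x)
  -- A projector onto `ker δ = range δ'`. It shows that an element of `range δ'` lying in `I • E`
  -- already lies in `I • range δ' = δ'(I • E)`.
  let ρ : E →ₗ[T] E := LinearMap.id - s ∘ₗ δ.rangeRestrict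
  have hρ : LinearMap.range ρ ≤ LinearMap.range δ' := by
    rintro _ ⟨x, rfl⟩
    exact (h _).1 (by simp [ρ, hs'])
  have hρw : ρ (δ' w) = δ' w := by
    have : δ.rangeRestrict (δ' w) = 0 := Subtype.ext (h.apply_apply_eq_zero w)
    simp [ρ, this]
  have h1 : δ' w ∈ Submodule.map δ' (I • (⊤ : Submodule T E)) := by
    rw [Submodule.map_smul'', Submodule.map_top]
    refine Submodule.smul_mono le_rfl hρ ?_
    rw [← Submodule.map_top, ← Submodule.map_smul'', ← hρw]
    exact Submodule.mem_map_of_mem hw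
  obtain ⟨w', hw', he⟩ := h1
  exact ⟨w', hw', by rw [map_sub, he, sub_self]⟩

end Periodic

/-! ### Tensor product of two matrix factorizations -/

section TensorProductOfFactorizations

open IsLocalRing Matrix

variable {T : Type u} [CommRing T] {n r : ℕ}

/-- The even differential of the tensor product of two matrix factorizations. -/
def tensorDiff (C D : Matrix (Fin n) (Fin n) T) (G H : Matrix (Fin r) (Fin r) T) :
    (Matrix (Fin n) (Fin r) T × Matrix (Fin n) (Fin r) T) →ₗ[T]
      (Matrix (Fin n) (Fin r) T × Matrix (Fin n) (Fin r) T) where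
  toFun w := (C * w.1 + w.2 * G, w.1 * H + D * w.2)
  map_add' w w' := by
    ext <;> simp [Matrix.mul_add, Matrix.add_mul] <;> ring
  map_smul' a w := by
    ext <;> simp [Matrix.mul_smul, Matrix.smul_mul]

/-- The mixed terms cancel, and so do `f` from the left factorization and `-f` from the sign-changed
right one. -/
lemma tensorDiff_tensorDiff {f : T} {C D : Matrix (Fin n) (Fin n) T}
    {G H : Matrix (Fin r) (Fin r) T} (hCD : C * D = f • 1) (hDC : D * C = f • 1)
    (hGH : G * H = f • 1) (hHG : H * G = f • 1)
    (w : Matrix (Fin n) (Fin r) T × Matrix (Fin n) (Fin r) T) :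
    tensorDiff D C (-G) (-H) (tensorDiff C D G H w) = 0 := by
  obtain ⟨u, v⟩ := w
  simp only [tensorDiff, LinearMap.coe_mk, AddHom.coe_mk, Prod.mk_eq_zero]
  constructor
  · rw [Matrix.mul_add, ← Matrix.mul_assoc, hDC, Matrix.add_mul, Matrix.mul_neg, Matrix.mul_neg,
      Matrix.mul_assoc u, hHG, Matrix.mul_assoc D]
    simp
    abel
  · rw [Matrix.mul_add, ← Matrix.mul_assoc C D, hCD, Matrix.add_mul, Matrix.mul_neg,
      Matrix.mul_neg, Matrix.mul_assoc v, hGH, Matrix.mul_assoc C]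
    simp
    abel

/-- Matrices modulo right multiples of `G` are elements of `Nⁿ`. For a cycle `(u, v)` the class of
`u` is killed by `C`, hence lies in the image of `D`; lifting gives a boundary with first entry `u`.
Its second entry must be `v`, since right multiplication by `G` is injective. -/
lemma tensorDiff_exact {f : T} {C D : Matrix (Fin n) (Fin n) T}
    {G H : Matrix (Fin r) (Fin r) T} (hCD : C * D = f • 1) (hDC : D * C = f • 1)
    (hGH : G * H = f • 1) (hHG : H * G = f • 1)
    (hG : ∀ v : Matrix (Fin n) (Fin r) T, v * G = 0 → v = 0)
    {N : Type*} [AddCommGroup N] [Module T N] (q : (Fin r → T) →ₗ[T] N)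
    (hq : Function.Surjective q) (hker : ∀ x, q x = 0 ↔ ∃ z, z ᵥ* G = x)
    (hex : D.ActExact C N) :
    Function.Exact (tensorDiff D C (-G) (-H)) (tensorDiff C D G H) := by
  have key : ∀ u : Matrix (Fin n) (Fin r) T, (∀ i, q (u i) = 0) →
      ∃ z : Matrix (Fin n) (Fin r) T, z * G = u := by
    intro u hu
    choose z hz using fun i => (hker _).1 (hu i)
    refine ⟨Matrix.of z, ?_⟩
    ext i j
    rw [← hz i]
    rfl
  have hact : ∀ (V : Matrix (Fin n) (Fin n) T) (u : Matrix (Fin n) (Fin r) T),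
      V.act N (fun i => q (u i)) = fun i => q ((V * u) i) := by
    intro V u
    rw [Matrix.act_comp q V u]
    ext i
    congr 1
    ext j
    rw [Matrix.mul_apply]
    exact (congrFun (Matrix.act_apply V (fun i => u i) i) j).trans (Finset.sum_apply _ _ _)
  intro w
  constructor
  · obtain ⟨u, v⟩ := w
    intro hw
    have hw1 : C * u + v * G = 0 := congrArg Prod.fst hw
    obtain ⟨y, hy⟩ := hex (fun i => q (u i)) (by
      rw [hact]
      ext i
      rw [eq_neg_of_add_eq_zero_left hw1]
      exact (hker _).2 ⟨-v i, by rw [Matrix.neg_vecMul]; rfl⟩)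
    choose a ha using fun i => hq (y i)
    have hy' : ∀ i, q ((u - D * Matrix.of a) i) = 0 := by
      intro i
      have h1 := congrFun (hact D (Matrix.of a)) i
      have h2 : (fun i => q (Matrix.of a i)) = y := funext ha
      rw [h2, hy] at h1
      have h3 : (u - D * Matrix.of a) i = u i - (D * Matrix.of a) i := rfl
      rw [h3, map_sub, sub_eq_zero]
      exact h1
    obtain ⟨z, hz⟩ := key _ hy'
    have hu : u = (tensorDiff D C (-G) (-H) (Matrix.of a, -z)).1 := by
      change u = D * Matrix.of a + -z * -G
      rw [Matrix.neg_mul, Matrix.mul_neg, neg_neg, hz]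
      abel
    refine ⟨(Matrix.of a, -z), ?_⟩
    have h4 := tensorDiff_tensorDiff (G := -G) (H := -H) hDC hCD (by simpa using hGH)
      (by simpa using hHG) (Matrix.of a, -z)
    rw [neg_neg, neg_neg] at h4
    set w' := tensorDiff D C (-G) (-H) (Matrix.of a, -z) with hw'
    have h5 : C * w'.1 + w'.2 * G = 0 := congrArg Prod.fst h4
    refine Prod.ext hu.symm ?_
    have h6 : (v - w'.2) * G = 0 := by
      rw [Matrix.sub_mul, sub_eq_zero]
      rw [← hu] at h5
      exact add_left_cancel (hw1.trans h5.symm)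
    exact (sub_eq_zero.1 (hG _ h6)).symm
  · rintro ⟨w', rfl⟩
    have h4 := tensorDiff_tensorDiff (G := -G) (H := -H) hDC hCD (by simpa using hGH)
      (by simpa using hHG) w'
    rwa [neg_neg, neg_neg] at h4

/-- If the tensor product of two matrix factorizations over a regular local ring is acyclic, where
`C` and `G` are minimal, then one of the factorizations is trivial. -/
theorem isUnit_det_or_isUnit_det [IsRegularLocalRing T] {f : T} {C D : Matrix (Fin n) (Fin n) T}
    {G H : Matrix (Fin r) (Fin r) T} (hCD : C * D = f • 1) (hDC : D * C = f • 1)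
    (hGH : G * H = f • 1) (hHG : H * G = f • 1)
    (hG : ∀ v : Matrix (Fin n) (Fin r) T, v * G = 0 → v = 0)
    (hCm : ∀ i j, C i j ∈ maximalIdeal T) (hGm : ∀ i j, G i j ∈ maximalIdeal T)
    {N : Type*} [AddCommGroup N] [Module T N] (q : (Fin r → T) →ₗ[T] N)
    (hq : Function.Surjective q) (hker : ∀ x, q x = 0 ↔ ∃ z, z ᵥ* G = x)
    (hex : D.ActExact C N) (hex' : C.ActExact D N) :
    IsUnit D.det ∨ IsUnit H.det := by
  by_contra! hcon
  obtain ⟨hD, hH⟩ := hcon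
  have e1 := tensorDiff_exact hCD hDC hGH hHG hG q hq hker hex
  have e2 := tensorDiff_exact (G := -G) (H := -H) hDC hCD (by simpa using hGH)
    (by simpa using hHG) (fun v hv => hG v (by simpa using hv)) q hq (fun x => by
      rw [hker]
      constructor
      · rintro ⟨z, rfl⟩; exact ⟨-z, by simp [Matrix.neg_vecMul, Matrix.vecMul_neg]⟩
      · rintro ⟨z, rfl⟩; exact ⟨-z, by simp [Matrix.neg_vecMul, Matrix.vecMul_neg]⟩) hex'
  rw [neg_neg, neg_neg] at e2
  obtain ⟨d, hd⟩ := IsRegularLocalRing.exists_krullDim_eq T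
  have hP := projective_range_of_periodic d _ _ e1 e2
    (IsRegularLocalRing.hasProjectiveDimensionLE d T hd _)
  have hdet : ∀ {m : ℕ} (V : Matrix (Fin m) (Fin m) T), ¬ IsUnit V.det →
      (V.map (residue T)).det = 0 := by
    intro m V hV
    rw [← RingHom.mapMatrix_apply, ← RingHom.map_det, residue_eq_zero_iff]
    exact hV
  -- Nonzero kernel vectors `h` of `H` (on the left) and `l` of `D` over the residue field; the lift
  -- of their outer product is a cycle modulo `𝔪`.
  obtain ⟨h, hh0, hh⟩ := Matrix.exists_vecMul_eq_zero_iff.2 (hdet H hH)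
  obtain ⟨l, hl0, hl⟩ := Matrix.exists_mulVec_eq_zero_iff.2 (hdet D hD)
  choose h' hh' using fun i => residue_surjective (R := T) (h i)
  choose l' hl' using fun i => residue_surjective (R := T) (l i)
  obtain rfl : (fun i => residue T (h' i)) = h := funext hh'
  obtain rfl : (fun i => residue T (l' i)) = l := funext hl'
  have hmem : ∀ V : Matrix (Fin n) (Fin r) T, (∀ i j, V i j ∈ maximalIdeal T) →
      ∀ W : Matrix (Fin n) (Fin r) T, (∀ i j, W i j ∈ maximalIdeal T) →
      (V, W) ∈ maximalIdeal T • (⊤ : Submodule T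
        (Matrix (Fin n) (Fin r) T × Matrix (Fin n) (Fin r) T)) := by
    intro V hV W hW
    have : (V, W) = (∑ i, ∑ j, V i j • ((Matrix.single i j 1 : Matrix _ _ T),
          (0 : Matrix (Fin n) (Fin r) T))) +
        ∑ i, ∑ j, W i j • ((0 : Matrix (Fin n) (Fin r) T), (Matrix.single i j 1 : Matrix _ _ T)) := by
      refine Prod.ext ?_ ?_
      · simp only [Prod.fst_add, Prod.fst_sum, Prod.smul_fst, smul_zero, Finset.sum_const_zero,
          add_zero, Matrix.smul_single, smul_eq_mul, mul_one]
        exact Matrix.matrix_eq_sum_single V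
      · simp only [Prod.snd_add, Prod.snd_sum, Prod.smul_snd, smul_zero, Finset.sum_const_zero,
          zero_add, Matrix.smul_single, smul_eq_mul, mul_one]
        exact Matrix.matrix_eq_sum_single W
    rw [this]
    refine add_mem (sum_mem fun i _ => sum_mem fun j _ => ?_)
      (sum_mem fun i _ => sum_mem fun j _ => ?_)
    · exact Submodule.smul_mem_smul (hV i j) trivial
    · exact Submodule.smul_mem_smul (hW i j) trivial
  have hw : tensorDiff D C (-G) (-H) (Matrix.vecMulVec l' h', 0) ∈ maximalIdeal T •
      (⊤ : Submodule T (Matrix (Fin n) (Fin r) T × Matrix (Fin n) (Fin r) T)) := by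
    simp only [tensorDiff, LinearMap.coe_mk, AddHom.coe_mk, Matrix.zero_mul, add_zero,
      Matrix.mul_zero]
    refine hmem _ (fun i j => ?_) _ (fun i j => ?_)
    · rw [Matrix.mul_vecMulVec, Matrix.vecMulVec_apply]
      refine Ideal.mul_mem_right _ _ ?_
      rw [← residue_eq_zero_iff]
      refine Eq.trans ?_ (congrFun hl i)
      simp [Matrix.mulVec, dotProduct]
    · rw [Matrix.mul_neg, Matrix.vecMulVec_mul, Matrix.neg_apply, Matrix.vecMulVec_apply]
      refine neg_mem (Ideal.mul_mem_left _ _ ?_)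
      rw [← residue_eq_zero_iff]
      refine Eq.trans ?_ (congrFun hh j)
      simp [Matrix.vecMul, dotProduct]
  -- Correct the cycle modulo `𝔪` to a true cycle, hence a boundary. The first entry of a boundary
  -- is `C * a + b * G`, which is in `𝔪` by minimality, so all products `l i * h j` vanish in the
  -- residue field.
  obtain ⟨w', hw', he⟩ := exists_mem_smul_top_of_periodic (maximalIdeal T) _ _ e1 hP hw
  obtain ⟨⟨a, b⟩, hab⟩ := (e2 _).1 he
  have hw1 : ∀ i j, w'.1 i j ∈ maximalIdeal T := by
    refine Submodule.smul_induction_on (p := fun w' => ∀ i j, w'.1 i j ∈ maximalIdeal T) hw' ?_ ?_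
    · intro x hx y _ i j
      exact Ideal.mul_mem_right _ _ hx
    · intro x y hx hy i j
      exact add_mem (hx i j) (hy i j)
  have hu : ∀ i j, Matrix.vecMulVec l' h' i j ∈ maximalIdeal T := by
    intro i j
    have h1 : C * a + b * G = Matrix.vecMulVec l' h' - w'.1 := congrArg Prod.fst hab
    have h2 : Matrix.vecMulVec l' h' i j = (C * a) i j + (b * G) i j + w'.1 i j := by
      have := congrFun (congrFun h1 i) j
      rw [Matrix.add_apply, Matrix.sub_apply] at this
      rw [this]; ring
    rw [h2, Matrix.mul_apply, Matrix.mul_apply]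
    refine add_mem (add_mem (sum_mem fun k _ => ?_) (sum_mem fun k _ => ?_)) (hw1 i j)
    · exact Ideal.mul_mem_right _ _ (hCm _ _)
    · exact Ideal.mul_mem_left _ _ (hGm _ _)
  obtain ⟨i, hi⟩ := Function.ne_iff.1 hl0
  obtain ⟨j, hj⟩ := Function.ne_iff.1 hh0
  have := (residue_eq_zero_iff _).2 (hu i j)
  rw [Matrix.vecMulVec_apply, map_mul] at this
  exact mul_ne_zero hi hj this

end TensorProductOfFactorizations

/-! ### Minimal matrix factorizations -/

section MatrixFactorization

open IsLocalRing TensorProduct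

variable {T : Type u} [CommRing T]

/-- Lift a basis of `X/𝔪X`: Nakayama gives surjectivity, and linear independence forces the
coefficients of any relation into `𝔪`. -/
lemma exists_minimal_cover [IsLocalRing T] (X : Type*) [AddCommGroup X] [Module T X]
    [Module.Finite T X] : ∃ (n : ℕ) (q : (Fin n → T) →ₗ[T] X), Function.Surjective q ∧
      ∀ x, q x = 0 → ∀ i, x i ∈ maximalIdeal T := by
  let b := Module.finBasis (ResidueField T) (ResidueField T ⊗[T] X)
  have hsurj : Function.Surjective (TensorProduct.mk T (ResidueField T) X 1) :=
    TensorProduct.mk_surjective T X (ResidueField T) residue_surjective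
  choose g hg using fun i => hsurj (b i)
  refine ⟨_, Fintype.linearCombination T g, ?_, fun x hx i => ?_⟩
  · rw [← LinearMap.range_eq_top, Fintype.range_linearCombination]
    exact span_eq_top_of_tmul_eq_basis g b hg
  · have h1 : ∑ i, residue T (x i) • b i = 0 := by
      rw [Fintype.linearCombination_apply] at hx
      rw [← map_zero (TensorProduct.mk T (ResidueField T) X 1), ← hx, map_sum]
      refine Finset.sum_congr rfl fun i _ => ?_
      rw [map_smul, hg]
      rfl
    have h2 := Fintype.linearIndependent_iff.1 b.linearIndependent _ h1 i
    exact (residue_eq_zero_iff _).1 h2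

/-- A module of projective dimension at most one annihilated by a nonzerodivisor `f` is the
cokernel of a minimal matrix factorization of `f`. -/
lemma exists_minimal_matrixFactorization [IsLocalRing T] [IsNoetherianRing T] [IsDomain T]
    {f : T} (hf : f ≠ 0) (X : Type u) [AddCommGroup X] [Module T X] [Module.Finite T X]
    (hfX : ∀ x : X, f • x = 0) (hpd : HasProjectiveDimensionLE (ModuleCat.of T X) 1) :
    ∃ (n : ℕ) (q : (Fin n → T) →ₗ[T] X) (A B : Matrix (Fin n) (Fin n) T),
      Function.Surjective q ∧ (∀ x, q x = 0 ↔ ∃ z, A.mulVec z = x) ∧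
      A * B = f • 1 ∧ B * A = f • 1 ∧ (∀ i j, A i j ∈ maximalIdeal T) := by
  obtain ⟨n, q, hq, hmin⟩ := exists_minimal_cover (T := T) X
  have hP : Module.Projective T (LinearMap.ker q) :=
    (ModuleCat.hasProjectiveDimensionLE_zero_iff _).1
      ((ModuleCat.hasProjectiveDimensionLE_succ_iff (Submodule.injective_subtype _)
        (LinearMap.exact_subtype_ker_map q) hq 0).1 hpd)
  have hfree : Module.Free T (LinearMap.ker q) := Module.free_of_flat_of_isLocalRing
  let mulf : (Fin n → T) →ₗ[T] LinearMap.ker q :=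
    (f • LinearMap.id).codRestrict _ (fun x => by simp [hfX])
  have hmulf : Function.Injective mulf := by
    intro x y hxy
    have : f • x = f • y := congrArg Subtype.val hxy
    ext i
    exact mul_left_cancel₀ hf (congrFun this i)
  let b₀ := Module.finBasis T (LinearMap.ker q)
  -- The presentation is square because the free module `ker q` lies between `f • Tⁿ` and `Tⁿ`. Then
  -- `A` is its inclusion and `B` is multiplication by `f` into it.
  have hcard : Module.finrank T (LinearMap.ker q) = n := by
    refine le_antisymm ?_ ?_
    · exact le_of_fin_injective T ((LinearMap.ker q).subtype ∘ₗ b₀.equivFun.symm.toLinearMap)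
        ((Submodule.injective_subtype _).comp b₀.equivFun.symm.injective)
    · exact le_of_fin_injective T (b₀.equivFun.toLinearMap ∘ₗ mulf)
        (b₀.equivFun.injective.comp hmulf)
  let e : LinearMap.ker q ≃ₗ[T] (Fin n → T) := (b₀.reindex (finCongr hcard)).equivFun
  let α : (Fin n → T) →ₗ[T] (Fin n → T) := (LinearMap.ker q).subtype ∘ₗ e.symm.toLinearMap
  let β : (Fin n → T) →ₗ[T] (Fin n → T) := e.toLinearMap ∘ₗ mulf
  have hαβ : α ∘ₗ β = f • LinearMap.id := by
    exact LinearMap.ext fun x => by simp [α, β, mulf]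
  have hα : Function.Injective α := (Submodule.injective_subtype _).comp e.symm.injective
  have hβα : β ∘ₗ α = f • LinearMap.id := by
    refine LinearMap.ext fun y => hα ?_
    have := LinearMap.congr_fun hαβ (α y)
    simp only [LinearMap.comp_apply, LinearMap.smul_apply, LinearMap.id_apply] at this ⊢
    rw [this, map_smul]
  refine ⟨n, q, LinearMap.toMatrix' α, LinearMap.toMatrix' β, hq, fun x => ?_, ?_, ?_, ?_⟩
  · simp_rw [LinearMap.toMatrix'_mulVec]
    constructor
    · intro hx
      exact ⟨e ⟨x, hx⟩, by simp [α]⟩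
    · rintro ⟨z, rfl⟩
      exact (e.symm z).2
  · rw [← LinearMap.toMatrix'_comp, hαβ, map_smul, LinearMap.toMatrix'_id]
  · rw [← LinearMap.toMatrix'_comp, hβα, map_smul, LinearMap.toMatrix'_id]
  · intro i j
    rw [LinearMap.toMatrix'_apply]
    exact hmin _ (e.symm _).2 i

end MatrixFactorization

/-! ### Modules over the hypersurface `S = T/(f)` -/

section Hypersurface

open IsLocalRing TensorProduct

variable {T S : Type u} [CommRing T] [CommRing S] [Algebra T S] {f : T}

lemma smul_eq_zero_of_algebraMap_eq_zero (hfS : algebraMap T S f = 0) {X : Type*} [AddCommGroup X]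
    [Module S X] [Module T X] [IsScalarTower T S X] (x : X) : f • x = 0 := by
  rw [← algebraMap_smul S f x, hfS, zero_smul]

lemma exists_linearMap_exact_map
    (hsurj : Function.Surjective (algebraMap T S))
    {X : Type*} [AddCommGroup X] [Module S X] [Module T X] [IsScalarTower T S X] {n : ℕ}
    {q : (Fin n → T) →ₗ[T] X} {A : Matrix (Fin n) (Fin n) T} (hq : Function.Surjective q)
    (hqA : ∀ x, q x = 0 ↔ ∃ z, A.mulVec z = x) :
    ∃ g : (Fin n → S) →ₗ[S] X, Function.Surjective g ∧
      Function.Exact ((A.map (algebraMap T S)).act S) g := by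
  let g : (Fin n → S) →ₗ[S] X := Fintype.linearCombination S fun i => q (Pi.single i 1)
  have hg : ∀ t : Fin n → T, g (fun i => algebraMap T S (t i)) = q t := by
    intro t
    rw [Fintype.linearCombination_apply]
    conv_rhs => rw [pi_eq_sum_univ' t, map_sum]
    refine Finset.sum_congr rfl fun i _ => ?_
    rw [algebraMap_smul, map_smul]
  have hA : ∀ z : Fin n → T, (A.map (algebraMap T S)).act S (fun i => algebraMap T S (z i)) =
      fun i => algebraMap T S (A.mulVec z i) := fun z => by
    rw [Matrix.act_map]
    exact Matrix.act_comp (Algebra.linearMap T S) A z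
  refine ⟨g, fun x => ?_, fun s => ?_⟩
  · obtain ⟨t, rfl⟩ := hq x
    exact ⟨_, hg t⟩
  · choose t ht using fun i => hsurj (s i)
    obtain rfl : (fun i => algebraMap T S (t i)) = s := funext ht
    rw [hg]
    constructor
    · intro h
      obtain ⟨z, rfl⟩ := (hqA t).1 h
      exact ⟨_, hA z⟩
    · rintro ⟨w, hw⟩
      choose z hz using fun i => hsurj (w i)
      obtain rfl : (fun i => algebraMap T S (z i)) = w := funext hz
      rw [← hg, ← hw, hA, hg]
      exact (hqA _).2 ⟨z, rfl⟩

/-- If `B` is invertible then `A = f B⁻¹` acts as zero over `S`, so the presentation map is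
injective. -/
lemma free_of_isUnit_det (hfS : algebraMap T S f = 0) (hsurj : Function.Surjective (algebraMap T S))
    {X : Type*} [AddCommGroup X] [Module S X] [Module T X] [IsScalarTower T S X] {n : ℕ}
    {q : (Fin n → T) →ₗ[T] X} {A B : Matrix (Fin n) (Fin n) T} (hq : Function.Surjective q)
    (hqA : ∀ x, q x = 0 ↔ ∃ z, A.mulVec z = x) (hAB : A * B = f • 1)
    (hB : IsUnit B.det) : Module.Free S X := by
  obtain ⟨g, hg, hgA⟩ := exists_linearMap_exact_map hsurj hq hqA
  refine Module.Free.of_equiv (LinearEquiv.ofBijective g ⟨?_, hg⟩)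
  rw [injective_iff_map_eq_zero]
  intro s hs
  obtain ⟨w, rfl⟩ := (hgA s).1 hs
  have h1 : A = f • 1 * B⁻¹ := by
    rw [← hAB, Matrix.mul_assoc, Matrix.mul_nonsing_inv _ hB, Matrix.mul_one]
  rw [Matrix.act_map, h1, ← Matrix.act_act, Matrix.act_smul_one]
  exact smul_eq_zero_of_algebraMap_eq_zero hfS _

lemma hasProjectiveDimensionLE_one_pi [IsDomain T] (hf : f ≠ 0)
    (hker : ∀ t, algebraMap T S t = 0 ↔ ∃ a, t = f * a)
    (hsurj : Function.Surjective (algebraMap T S)) (k : ℕ) :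
    HasProjectiveDimensionLE (ModuleCat.of T (Fin k → S)) 1 := by
  let p : (Fin k → T) →ₗ[T] (Fin k → S) := (Algebra.linearMap T S).compLeft (Fin k)
  let i : (Fin k → T) →ₗ[T] (Fin k → T) := f • LinearMap.id
  have hi : Function.Injective i := fun x y hxy => by
    ext j
    exact mul_left_cancel₀ hf (congrFun hxy j)
  have hp : Function.Surjective p := fun s => by
    choose t ht using fun i => hsurj (s i)
    exact ⟨t, funext ht⟩
  have hip : Function.Exact i p := by
    intro x
    constructor
    · intro hx
      choose a ha using fun j => (hker _).1 (congrFun hx j)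
      exact ⟨a, funext fun j => (ha j).symm⟩
    · rintro ⟨a, rfl⟩
      ext j
      exact (hker _).2 ⟨a j, rfl⟩
  rw [ModuleCat.hasProjectiveDimensionLE_succ_iff hi hip hp 0,
    ModuleCat.hasProjectiveDimensionLE_zero_iff]
  infer_instance

/-- Lift to `T`: from `D y' = f w` follows `f y' = C D y' = f C w`, and `f` cancels. -/
lemma actExact_pi [IsDomain T] (hf : f ≠ 0)
    (hker : ∀ t, algebraMap T S t = 0 ↔ ∃ a, t = f * a)
    (hsurj : Function.Surjective (algebraMap T S)) {n : ℕ} {C D : Matrix (Fin n) (Fin n) T}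
    (hCD : C * D = f • 1) (k : ℕ) : C.ActExact D (Fin k → S) := by
  intro y hy
  choose y' hy' using fun i j => hsurj (y i j)
  obtain rfl : (fun i j => algebraMap T S (y' i j)) = y := by ext i j; exact hy' i j
  let p : (Fin k → T) →ₗ[T] (Fin k → S) := (Algebra.linearMap T S).compLeft (Fin k)
  have hp : ∀ y : Fin n → Fin k → T, (fun i j => algebraMap T S (y i j)) = fun i => p (y i) :=
    fun y => rfl
  rw [hp, Matrix.act_comp] at hy
  choose w hw using fun i j => (hker _).1 (congrFun (congrFun hy i) j)
  have hw' : D.act (Fin k → T) y' = f • w := by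
    ext i j; exact hw i j
  refine ⟨fun i => p (w i), ?_⟩
  have h1 : C.act (Fin k → T) (D.act (Fin k → T) y') = C.act (Fin k → T) (f • w) := by rw [hw']
  rw [Matrix.act_act, hCD, Matrix.act_smul_one, map_smul] at h1
  have h2 : y' = C.act (Fin k → T) w := by
    ext i j
    exact mul_left_cancel₀ hf (congrFun (congrFun h1 i) j)
  rw [Matrix.act_comp, ← h2]
  rfl

/-- The connecting-map chase for the 2-periodic complexes on `K`, `F`, `N`. Replacing `w` by `w - D
z'` moves it into `K` without changing `C w`, because `C D = f` kills `F`. -/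
lemma Matrix.ActExact.ker {n : ℕ} {C D : Matrix (Fin n) (Fin n) T} (hCD : C * D = f • 1)
    {F N : Type*} [AddCommGroup F] [Module T F] [AddCommGroup N] [Module T N] (p : F →ₗ[T] N)
    (hfF : ∀ x : F, f • x = 0)
    (hp : Function.Surjective p) (hF : C.ActExact D F) (hN : D.ActExact C N) {K : Type*}
    [AddCommGroup K] [Module T K] (i : K →ₗ[T] F) (hi : Function.Injective i)
    (hip : Function.Exact i p) : C.ActExact D K := by
  intro y hy
  have h1 : D.act F (fun j => i (y j)) = 0 := by
    rw [Matrix.act_comp, hy]; ext j; simp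
  obtain ⟨w, hw⟩ := hF _ h1
  have h2 : C.act N (fun j => p (w j)) = 0 := by
    rw [Matrix.act_comp, hw]; ext j; simp [hip.apply_apply_eq_zero]
  obtain ⟨z, hz⟩ := hN _ h2
  choose z' hz' using fun j => hp (z j)
  have h3 : ∀ j, p (w j - D.act F z' j) = 0 := by
    intro j
    have := congrFun (Matrix.act_comp p D z') j
    rw [map_sub, ← this, funext hz', hz, sub_self]
  choose v hv using fun j => (hip _).1 (h3 j)
  refine ⟨v, ?_⟩
  have h4 : (fun j => i (C.act K v j)) = fun j => i (y j) := by
    rw [← Matrix.act_comp, ← hw]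
    have : (fun j => i (v j)) = w - D.act F z' := funext hv
    rw [this, map_sub, Matrix.act_act, hCD, Matrix.act_smul_one]
    have hz : f • z' = 0 := funext fun j => hfF _
    rw [hz, sub_zero]
  ext j
  exact hi (congrFun h4 j)

/-- Let `S = T / (f)` with `T` regular local and let `(C, D)` be a nontrivial minimal matrix
factorization of `f`. If its action on `N` is exact, then `N` has finite projective dimension
over `S`. -/
theorem exists_hasProjectiveDimensionLE_of_actExact [IsRegularLocalRing T] (hf : f ≠ 0)
    (hker : ∀ t, algebraMap T S t = 0 ↔ ∃ a, t = f * a)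
    (hsurj : Function.Surjective (algebraMap T S)) {n : ℕ} {C D : Matrix (Fin n) (Fin n) T}
    (hCD : C * D = f • 1) (hDC : D * C = f • 1) (hCm : ∀ i j, C i j ∈ maximalIdeal T)
    (hD : ¬ IsUnit D.det) (d : ℕ) : ∀ (N : Type u) [AddCommGroup N] [Module S N] [Module T N]
      [IsScalarTower T S N] [Module.Finite S N],
      HasProjectiveDimensionLE (ModuleCat.of T N) (d + 1) → C.ActExact D N → D.ActExact C N →
      ∃ e : ℕ, HasProjectiveDimensionLE (ModuleCat.of S N) e := by
  have := IsRegularLocalRing.isDomain T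
  have hfS : algebraMap T S f = 0 := (hker f).2 ⟨1, by simp⟩
  have hTS : Module.Finite T S := .of_surjective (Algebra.linearMap T S) hsurj
  have hSN : IsNoetherianRing S := isNoetherianRing_of_surjective T S (algebraMap T S) hsurj
  induction d with
  | zero =>
    intro N _ _ _ _ _ hpd h1 h2
    have : Module.Finite T N := .trans S N
    obtain ⟨r, q, A, B, hq, hqA, hAB, hBA, hA⟩ := exists_minimal_matrixFactorization hf N
      (smul_eq_zero_of_algebraMap_eq_zero hfS) hpd
    have hGH : A.transpose * B.transpose = f • 1 := by
      rw [← Matrix.transpose_mul, hBA, Matrix.transpose_smul, Matrix.transpose_one]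
    have hHG : B.transpose * A.transpose = f • 1 := by
      rw [← Matrix.transpose_mul, hAB, Matrix.transpose_smul, Matrix.transpose_one]
    -- The factorization of `N` enters transposed, as `G` and `H` act on rows from the right.
    rcases isUnit_det_or_isUnit_det hCD hDC hGH hHG (fun v hv => by
        have h3 : v * (A.transpose * B.transpose) = 0 := by
          rw [← Matrix.mul_assoc, hv, Matrix.zero_mul]
        rw [hGH, Matrix.mul_smul, Matrix.mul_one] at h3
        ext i j
        exact (mul_eq_zero.1 (congrFun (congrFun h3 i) j)).resolve_left hf) hCm
      (fun i j => hA j i) q hq (fun x => by simp_rw [hqA, Matrix.vecMul_transpose]) h2 h1 with h | h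
    · exact absurd h hD
    · rw [Matrix.det_transpose] at h
      have : Module.Free S N := free_of_isUnit_det hfS hsurj hq hqA hAB h
      exact ⟨0, (ModuleCat.hasProjectiveDimensionLE_zero_iff N).2 inferInstance⟩
  | succ d ih =>
    intro N _ _ _ _ _ hpd h1 h2
    obtain ⟨k, p, hp⟩ := Module.Finite.exists_fin' S N
    let K := LinearMap.ker p
    have hi : Function.Injective K.subtype := Submodule.injective_subtype _
    have hip : Function.Exact K.subtype p := LinearMap.exact_subtype_ker_map p
    have hF : ∀ x : Fin k → S, f • x = 0 := smul_eq_zero_of_algebraMap_eq_zero hfS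
    obtain ⟨w, hs⟩ := ModuleCat.exists_shortExact (A := T) (i := K.subtype.restrictScalars T)
      (p := p.restrictScalars T) hi hip hp
    -- Since `S` has projective dimension at most 1 over `T`, a syzygy over `S` lowers the bound
    -- over `T` until it reaches 1, hence the offset `d + 1`.
    have hK : HasProjectiveDimensionLE (ModuleCat.of T K) (d + 1) := by
      have h3 : HasProjectiveDimensionLE (ModuleCat.of T (Fin k → S)) 1 :=
        hasProjectiveDimensionLE_one_pi hf hker hsurj k
      exact hs.hasProjectiveDimensionLT_X₁ (d + 2)
        (hasProjectiveDimensionLT_of_ge _ 2 (d + 2) (by omega)) hpd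
    obtain ⟨e, he⟩ := ih K hK
      (Matrix.ActExact.ker hCD (p.restrictScalars T) hF hp (actExact_pi hf hker hsurj hCD k) h2
        (K.subtype.restrictScalars T) hi hip)
      (Matrix.ActExact.ker hDC (p.restrictScalars T) hF hp (actExact_pi hf hker hsurj hDC k) h1
        (K.subtype.restrictScalars T) hi hip)
    exact ⟨e + 1, (ModuleCat.hasProjectiveDimensionLE_succ_iff hi hip hp e).2 he⟩

end Hypersurface

/-! ### Tor of the images in a two-periodic resolution -/

section PeriodicTor

open TensorProduct

variable {S : Type u} [CommRing S] {n : ℕ} {V W : Matrix (Fin n) (Fin n) S}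

lemma subsingleton_torModule_one_iff {K F X : Type u} [AddCommGroup K] [Module S K]
    [AddCommGroup F] [Module S F] [AddCommGroup X] [Module S X] [Module.Projective S F]
    {i : K →ₗ[S] F} {p : F →ₗ[S] X}
    (hi : Function.Injective i) (hip : Function.Exact i p) (hp : Function.Surjective p)
    (N : Type u) [AddCommGroup N] [Module S N] :
    Subsingleton (torModule S X N 1) ↔ Function.Injective (i.rTensor N) := by
  obtain ⟨e⟩ := nonempty_torModule_one_equiv hi hip hp N
  rw [e.toEquiv.subsingleton_congr, Submodule.subsingleton_iff_eq_bot, LinearMap.ker_eq_bot]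

/-- `Sⁿ ⊗ N ≃ Nⁿ`. -/
noncomputable def piTensorEquiv (S : Type*) [CommRing S] (n : ℕ) (N : Type*) [AddCommGroup N]
    [Module S N] : (Fin n → S) ⊗[S] N ≃ₗ[S] (Fin n → N) :=
  TensorProduct.comm S _ _ ≪≫ₗ TensorProduct.piScalarRight S S N (Fin n)

lemma piTensorEquiv_rTensor (V : Matrix (Fin n) (Fin n) S) {N : Type*} [AddCommGroup N]
    [Module S N] (t : (Fin n → S) ⊗[S] N) :
    piTensorEquiv S n N ((V.act S).rTensor N t) = V.act N (piTensorEquiv S n N t) := by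
  induction t with
  | zero => simp
  | add x y hx hy => simp only [map_add, hx, hy]
  | tmul x y =>
    ext j
    simp [piTensorEquiv, Matrix.act_apply, Finset.sum_smul, mul_smul]

lemma Matrix.exact_range_act (hVW : ∀ y, V.act S (W.act S y) = 0) (h : W.ActExact V S) :
    Function.Exact (LinearMap.range (W.act S)).subtype (V.act S).rangeRestrict := by
  intro x
  rw [Subtype.ext_iff]
  constructor
  · intro hx
    exact ⟨⟨x, h x hx⟩, rfl⟩
  · rintro ⟨⟨_, y, rfl⟩, rfl⟩
    exact hVW y

/-- `Tor₁` is the kernel of `im W ⊗ N → Nⁿ`. Since `im W` is the cokernel of `V`, this kernel is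
`ker W / im V` on `Nⁿ`. -/
lemma subsingleton_torModule_range_one (hVW : ∀ y, V.act S (W.act S y) = 0)
    (hWV : ∀ y, W.act S (V.act S y) = 0) (h : W.ActExact V S) (h' : V.ActExact W S) (N : Type u)
    [AddCommGroup N] [Module S N] :
    Subsingleton (torModule S (LinearMap.range (V.act S)) N 1) ↔ V.ActExact W N := by
  let i := (LinearMap.range (W.act S)).subtype
  let π := (W.act S).rangeRestrict
  have hi : Function.Injective i := Submodule.injective_subtype _
  have hπ : Function.Surjective π := (W.act S).surjective_rangeRestrict
  rw [subsingleton_torModule_one_iff hi (Matrix.exact_range_act hVW h)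
    (V.act S).surjective_rangeRestrict N, injective_iff_map_eq_zero]
  have hex : Function.Exact (V.act S) π := by
    intro x
    rw [Subtype.ext_iff]
    exact ⟨h' x, by rintro ⟨y, rfl⟩; exact hWV y⟩
  have hexN := rTensor_exact N hex hπ
  have hcomp : ∀ t, i.rTensor N (π.rTensor N t) = (W.act S).rTensor N t := fun t => by
    rw [← LinearMap.comp_apply, ← LinearMap.rTensor_comp]; rfl
  constructor
  · intro H y hy
    have h1 : (W.act S).rTensor N ((piTensorEquiv S n N).symm y) = 0 := by
      apply (piTensorEquiv S n N).injective
      rw [piTensorEquiv_rTensor, LinearEquiv.apply_symm_apply, hy, map_zero]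
    rw [← hcomp] at h1
    obtain ⟨t, ht⟩ := (hexN _).1 (H _ h1)
    exact ⟨piTensorEquiv S n N t, by
      rw [← piTensorEquiv_rTensor, ht, LinearEquiv.apply_symm_apply]⟩
  · intro H x hx
    obtain ⟨t, rfl⟩ := LinearMap.rTensor_surjective N hπ x
    rw [hcomp] at hx
    obtain ⟨z, hz⟩ := H (piTensorEquiv S n N t) (by rw [← piTensorEquiv_rTensor, hx, map_zero])
    refine (hexN _).2 ⟨(piTensorEquiv S n N).symm z, ?_⟩
    apply (piTensorEquiv S n N).injective
    rw [piTensorEquiv_rTensor, LinearEquiv.apply_symm_apply, hz]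

lemma nonempty_torModule_range_equiv (hVW : ∀ y, V.act S (W.act S y) = 0) (h : W.ActExact V S)
    (N : Type u) [AddCommGroup N] [Module S N] (k : ℕ) :
    Nonempty (torModule S (LinearMap.range (V.act S)) N (k + 2) ≃ₗ[S]
      torModule S (LinearMap.range (W.act S)) N (k + 1)) :=
  nonempty_torModule_equiv (Submodule.injective_subtype _) (Matrix.exact_range_act hVW h)
    (V.act S).surjective_rangeRestrict N k

/-- The images of `V` and `W` are syzygies of each other, so Tor has period two. -/
lemma subsingleton_torModule_range (hVW : ∀ y, V.act S (W.act S y) = 0)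
    (hWV : ∀ y, W.act S (V.act S y) = 0) (h : W.ActExact V S) (h' : V.ActExact W S) (N : Type u)
    [AddCommGroup N] [Module S N] (e : ℕ) :
    (Subsingleton (torModule S (LinearMap.range (V.act S)) N (2 * e + 1)) ↔ V.ActExact W N) ∧
    (Subsingleton (torModule S (LinearMap.range (V.act S)) N (2 * e + 2)) ↔ W.ActExact V N) := by
  have hstep : ∀ k, Subsingleton (torModule S (LinearMap.range (V.act S)) N (k + 2)) ↔
      Subsingleton (torModule S (LinearMap.range (W.act S)) N (k + 1)) := fun k => by
    obtain ⟨E⟩ := nonempty_torModule_range_equiv hVW h N k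
    exact E.toEquiv.subsingleton_congr
  have hstep' : ∀ k, Subsingleton (torModule S (LinearMap.range (W.act S)) N (k + 2)) ↔
      Subsingleton (torModule S (LinearMap.range (V.act S)) N (k + 1)) := fun k => by
    obtain ⟨E⟩ := nonempty_torModule_range_equiv hWV h' N k
    exact E.toEquiv.subsingleton_congr
  induction e with
  | zero =>
    exact ⟨subsingleton_torModule_range_one hVW hWV h h' N,
      (hstep 0).trans (subsingleton_torModule_range_one hWV hVW h' h N)⟩
  | succ e ih =>
    exact ⟨((hstep (2 * e + 1)).trans (hstep' (2 * e))).trans ih.1,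
      ((hstep (2 * e + 2)).trans (hstep' (2 * e + 1))).trans ih.2⟩

end PeriodicTor

/-! ### The dual and `Ext¹` of the cokernel of a matrix -/

section Cokernel

variable {S : Type u} [CommRing S] {n : ℕ} {A B : Matrix (Fin n) (Fin n) S} {X : Type u}
  [AddCommGroup X] [Module S X]

/-- The dual of the cokernel of `A` is the kernel of the transpose of `A`. -/
lemma nonempty_dual_equiv_of_exact {q : (Fin n → S) →ₗ[S] X} (hq : Function.Surjective q)
    (hqA : Function.Exact (A.act S) q)
    (hAB : ∀ y, A.transpose.act S (B.transpose.act S y) = 0)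
    (h : B.transpose.ActExact A.transpose S) :
    Nonempty (Module.Dual S X ≃ₗ[S] LinearMap.range (B.transpose.act S)) := by
  let φ : Module.Dual S X →ₗ[S] (Fin n → S) :=
    { toFun := fun l i => l (q (Pi.single i 1))
      map_add' := fun _ _ => rfl
      map_smul' := fun _ _ => rfl }
  have hφ : Function.Injective φ := by
    intro l l' hl
    have : l ∘ₗ q = l' ∘ₗ q := by
      apply LinearMap.pi_ext'
      intro i
      ext
      exact congrFun hl i
    ext x
    obtain ⟨y, rfl⟩ := hq x
    exact LinearMap.congr_fun this y
  have hAt : ∀ (y x : Fin n → S), (A.act S x) ⬝ᵥ y = x ⬝ᵥ (A.transpose.act S y) := by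
    intro y x
    change A.mulVec x ⬝ᵥ y = x ⬝ᵥ A.transpose.mulVec y
    rw [Matrix.dotProduct_mulVec, Matrix.vecMul_transpose]
  have hφq : ∀ l x, l (q x) = x ⬝ᵥ φ l := by
    intro l x
    conv_lhs => rw [pi_eq_sum_univ' x, map_sum, map_sum]
    simp [dotProduct, φ]
  refine ⟨LinearEquiv.ofInjective φ hφ ≪≫ₗ LinearEquiv.ofEq _ _ (le_antisymm ?_ ?_)⟩
  · rintro _ ⟨l, rfl⟩
    refine h _ ?_
    ext j
    have := hAt (φ l) (Pi.single j 1)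
    rwa [← hφq, hqA.apply_apply_eq_zero, map_zero, single_one_dotProduct, eq_comm] at this
  · rintro y ⟨z, rfl⟩
    set y := B.transpose.act S z with hy
    have hy0 : A.transpose.act S y = 0 := hAB z
    let l₀ : (Fin n → S) →ₗ[S] S := Fintype.linearCombination S y
    have hl₀ : ∀ x, l₀ x = x ⬝ᵥ y := fun x => by
      simp [l₀, Fintype.linearCombination_apply, dotProduct]
    have hle : LinearMap.ker q ≤ LinearMap.ker l₀ := by
      intro x hx
      obtain ⟨w, rfl⟩ := (hqA x).1 hx
      rw [LinearMap.mem_ker, hl₀, hAt, hy0, dotProduct_zero]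
    refine ⟨((LinearMap.ker q).liftQ l₀ hle) ∘ₗ (q.quotKerEquivOfSurjective hq).symm.toLinearMap, ?_⟩
    ext i
    have h1 : (q.quotKerEquivOfSurjective hq).symm (q (Pi.single i 1)) =
        (LinearMap.ker q).mkQ (Pi.single i 1) := by
      rw [LinearEquiv.symm_apply_eq]
      rfl
    change (LinearMap.ker q).liftQ l₀ hle ((q.quotKerEquivOfSurjective hq).symm
      (q (Pi.single i 1))) = y i
    rw [h1, Submodule.mkQ_apply, Submodule.liftQ_apply, hl₀, single_one_dotProduct]

/-- If `Ext¹(coker A, N) = 0` then the action of the transposes on `N` is exact. -/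
lemma Matrix.ActExact.of_subsingleton_ext {q : (Fin n → S) →ₗ[S] X} (hq : Function.Surjective q)
    (hqA : Function.Exact (A.act S) q) (h : B.ActExact A S) (N : Type u) [AddCommGroup N]
    [Module S N] (hE : Subsingleton (Abelian.Ext (ModuleCat.of S X) (ModuleCat.of S N) 1)) :
    A.transpose.ActExact B.transpose N := by
  have hqA' : Function.Exact (LinearMap.range (A.act S)).subtype q := by
    intro x
    rw [hqA x]
    exact ⟨fun hx => ⟨⟨x, hx⟩, rfl⟩, by rintro ⟨⟨_, y, rfl⟩, rfl⟩; exact ⟨y, rfl⟩⟩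
  have hext := (ModuleCat.subsingleton_ext_one_iff (Submodule.injective_subtype _) hqA' hq N).1 hE
  intro y hy
  let φ : (Fin n → S) →ₗ[S] N := Fintype.linearCombination S y
  have hφ : ∀ (V : Matrix (Fin n) (Fin n) S) (z : Fin n → N) (x : Fin n → S),
      Fintype.linearCombination S z (V.act S x) =
        Fintype.linearCombination S (V.transpose.act N z) x := by
    intro V z x
    simp only [Fintype.linearCombination_apply, Matrix.act_apply, Finset.smul_sum,
      Finset.sum_smul, Matrix.transpose_apply, smul_smul, smul_eq_mul]
    rw [Finset.sum_comm]
    simp only [mul_comm]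
  -- `Bᵀ y = 0` says that `φ` vanishes on `im B`, which contains `ker A`, so `φ` descends to `im A`.
  -- An extension `g` to `Sⁿ` is a vector `z` with `Aᵀ z = y`.
  have hle : LinearMap.ker (A.act S) ≤ LinearMap.ker φ := by
    intro x hx
    obtain ⟨w, rfl⟩ := h x hx
    rw [LinearMap.mem_ker]
    change Fintype.linearCombination S y _ = 0
    rw [hφ, hy]
    simp [Fintype.linearCombination_apply]
  obtain ⟨g, hg⟩ := hext (((LinearMap.ker (A.act S)).liftQ φ hle) ∘ₗ
    (A.act S).quotKerEquivRange.symm.toLinearMap)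
  refine ⟨fun i => g (Pi.single i 1), ?_⟩
  have hgφ : ∀ x, g (A.act S x) = φ x := by
    intro x
    refine (LinearMap.congr_fun hg ⟨A.act S x, x, rfl⟩).trans ?_
    have h1 : (A.act S).quotKerEquivRange.symm ⟨A.act S x, x, rfl⟩ =
        (LinearMap.ker (A.act S)).mkQ x := by
      rw [LinearEquiv.symm_apply_eq]
      rfl
    rw [LinearMap.comp_apply, LinearEquiv.coe_coe, h1, Submodule.mkQ_apply, Submodule.liftQ_apply]
  have hgl : g = Fintype.linearCombination S fun i => g (Pi.single i 1) := by
    apply LinearMap.pi_ext'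
    intro i
    ext
    simp [Fintype.linearCombination_apply_single]
  ext i
  have h2 := hgφ (Pi.single i 1)
  rw [hgl, hφ] at h2
  simpa [φ, Fintype.linearCombination_apply_single] using h2

end Cokernel

/-! ### Faithfully flat base change and descent -/

section BaseChange

open TensorProduct

variable {R : Type u} [CommRing R]

lemma exists_projective_presentation (X : Type u) [AddCommGroup X] [Module R X] :
    ∃ (K F : Type u) (_ : AddCommGroup K) (_ : Module R K) (_ : AddCommGroup F) (_ : Module R F)
      (_ : Module.Projective R F) (i : K →ₗ[R] F) (p : F →ₗ[R] X), Function.Injective i ∧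
        Function.Exact i p ∧ Function.Surjective p := by
  let p : (X →₀ R) →ₗ[R] X := Finsupp.linearCombination R id
  have hip := LinearMap.exact_subtype_ker_map p
  exact ⟨LinearMap.ker p, X →₀ R, Submodule.addCommGroup _, Submodule.module _, _, _, inferInstance,
    (LinearMap.ker p).subtype, p,
    Submodule.injective_subtype _, hip,
    Finsupp.linearCombination_id_surjective R X⟩

variable (S : Type u) [CommRing S] [Algebra R S]

lemma baseChange_rTensor_injective_iff [Module.FaithfullyFlat R S] {K F : Type u} [AddCommGroup K]
    [Module R K] [AddCommGroup F] [Module R F] (i : K →ₗ[R] F) (N : Type u) [AddCommGroup N]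
    [Module R N] : Function.Injective ((i.baseChange S).rTensor (S ⊗[R] N)) ↔
      Function.Injective (i.rTensor N) := by
  rw [← Module.FaithfullyFlat.lTensor_injective_iff_injective R S]
  have h : ((i.baseChange S).rTensor (S ⊗[R] N)) ∘ₗ
      (AlgebraTensorModule.distribBaseChange R S K N).toLinearMap =
      (AlgebraTensorModule.distribBaseChange R S F N).toLinearMap ∘ₗ
        ((i.rTensor N).baseChange S) := by
    ext
    simp
  have h' : ⇑((i.baseChange S).rTensor (S ⊗[R] N)) ∘
      (AlgebraTensorModule.distribBaseChange R S K N) =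
      (AlgebraTensorModule.distribBaseChange R S F N) ∘ ((i.rTensor N).lTensor S) :=
    congrArg DFunLike.coe h
  rw [← EquivLike.injective_comp (AlgebraTensorModule.distribBaseChange R S K N), h',
    EquivLike.comp_injective]

/-- Vanishing of `Tor₁` is injectivity of a tensored map, which faithfully flat base change
preserves and reflects; dimension shifting does the rest. -/
lemma subsingleton_torModule_baseChange_iff [Module.FaithfullyFlat R S] (N : Type u)
    [AddCommGroup N] [Module R N] (k : ℕ) : ∀ (X : Type u) [AddCommGroup X] [Module R X],
    Subsingleton (torModule S (S ⊗[R] X) (S ⊗[R] N) (k + 1)) ↔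
      Subsingleton (torModule R X N (k + 1)) := by
  have main : ∀ (X : Type u) [AddCommGroup X] [Module R X], ∃ (K F : Type u) (_ : AddCommGroup K)
      (_ : Module R K) (_ : AddCommGroup F) (_ : Module R F) (_ : Module.Projective R F)
      (i : K →ₗ[R] F) (p : F →ₗ[R] X), Function.Injective i ∧ Function.Exact i p ∧
        Function.Surjective p ∧ Function.Injective (i.baseChange S) ∧
        Function.Exact (i.baseChange S) (p.baseChange S) ∧
        Function.Surjective (p.baseChange S) := by
    intro X _ _
    obtain ⟨K, F, _, _, _, _, _, i, p, hi, hip, hp⟩ := exists_projective_presentation (R := R) X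
    exact ⟨K, F, _, _, _, _, inferInstance, i, p, hi, hip, hp,
      Module.Flat.lTensor_preserves_injective_linearMap _ hi,
      lTensor_exact S hip hp, LinearMap.lTensor_surjective S hp⟩
  induction k with
  | zero =>
    intro X _ _
    obtain ⟨K, F, _, _, _, _, _, i, p, hi, hip, hp, hi', hip', hp'⟩ := main X
    exact (subsingleton_torModule_one_iff hi' hip' hp' (S ⊗[R] N)).trans
      ((baseChange_rTensor_injective_iff S i N).trans
        (subsingleton_torModule_one_iff hi hip hp N).symm)
  | succ k ih =>
    intro X _ _
    obtain ⟨K, F, _, _, _, _, _, i, p, hi, hip, hp, hi', hip', hp'⟩ := main X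
    obtain ⟨e⟩ := nonempty_torModule_equiv hi hip hp N k
    obtain ⟨e'⟩ := nonempty_torModule_equiv hi' hip' hp' (S ⊗[R] N) k
    rw [e.toEquiv.subsingleton_congr, e'.toEquiv.subsingleton_congr, ih]

/-- The syzygy is finitely presented, so every map out of its base change is an `S`-combination of
base-changed maps, and each of these extends. -/
lemma subsingleton_ext_one_baseChange [Module.Flat R S] [IsNoetherianRing R] (M N : Type u)
    [AddCommGroup M] [Module R M] [Module.Finite R M] [AddCommGroup N] [Module R N]
    (h : Subsingleton (Abelian.Ext (ModuleCat.of R M) (ModuleCat.of R N) 1)) :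
    Subsingleton (Abelian.Ext (ModuleCat.of S (S ⊗[R] M)) (ModuleCat.of S (S ⊗[R] N)) 1) := by
  obtain ⟨k, p, hp⟩ := Module.Finite.exists_fin' R M
  let i := (LinearMap.ker p).subtype
  have hi : Function.Injective i := Submodule.injective_subtype _
  have hip : Function.Exact i p := LinearMap.exact_subtype_ker_map p
  rw [ModuleCat.subsingleton_ext_one_iff hi hip hp] at h
  have hi' : Function.Injective (i.baseChange S) :=
    Module.Flat.lTensor_preserves_injective_linearMap _ hi
  have hip' : Function.Exact (i.baseChange S) (p.baseChange S) := lTensor_exact S hip hp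
  have hp' : Function.Surjective (p.baseChange S) := LinearMap.lTensor_surjective S hp
  rw [ModuleCat.subsingleton_ext_one_iff hi' hip' hp']
  have : Module.FinitePresentation R (LinearMap.ker p) :=
    Module.finitePresentation_of_finite R (LinearMap.ker p)
  intro g
  induction g using (Module.FinitePresentation.isBaseChange_map R (LinearMap.ker p) N S).inductionOn
    with
  | zero => exact ⟨0, by simp⟩
  | tmul m =>
    obtain ⟨l, rfl⟩ := h m
    exact ⟨l.baseChange S, (LinearMap.baseChange_comp ..).symm⟩
  | smul s x hx =>
    obtain ⟨l, rfl⟩ := hx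
    exact ⟨s • l, by rw [LinearMap.smul_comp]⟩
  | add x y hx hy =>
    obtain ⟨l, rfl⟩ := hx
    obtain ⟨l', rfl⟩ := hy
    exact ⟨l + l', by rw [LinearMap.add_comp]⟩

/-- Flat base change of the dual of a finitely presented module. -/
lemma nonempty_dual_baseChange_equiv [Module.Flat R S] (M : Type u) [AddCommGroup M] [Module R M]
    [Module.FinitePresentation R M] :
    Nonempty (S ⊗[R] Module.Dual R M ≃ₗ[S] Module.Dual S (S ⊗[R] M)) :=
  ⟨(Module.FinitePresentation.isBaseChange_map R M R S).equiv ≪≫ₗ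
    LinearEquiv.congrRight (AlgebraTensorModule.rid R S S)⟩

/-- Flatness descends, and finite flat modules over a local ring are free; syzygies reduce to this
case. -/
lemma hasProjectiveDimensionLE_of_baseChange [Module.FaithfullyFlat R S] [IsLocalRing R]
    [IsNoetherianRing R] (d : ℕ) : ∀ (N : Type u) [AddCommGroup N] [Module R N] [Module.Finite R N],
    HasProjectiveDimensionLE (ModuleCat.of S (S ⊗[R] N)) d →
      HasProjectiveDimensionLE (ModuleCat.of R N) d := by
  induction d with
  | zero =>
    intro N _ _ _ h
    rw [ModuleCat.hasProjectiveDimensionLE_zero_iff] at h ⊢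
    have : Module.Flat R N := Module.Flat.of_flat_tensorProduct R N S
    have : Module.Free R N := Module.free_of_flat_of_isLocalRing
    infer_instance
  | succ d ih =>
    intro N _ _ _ h
    obtain ⟨k, p, hp⟩ := Module.Finite.exists_fin' R N
    let i := (LinearMap.ker p).subtype
    have hi : Function.Injective i := Submodule.injective_subtype _
    have hip : Function.Exact i p := LinearMap.exact_subtype_ker_map p
    have hi' : Function.Injective (i.baseChange S) :=
      Module.Flat.lTensor_preserves_injective_linearMap _ hi
    have hip' : Function.Exact (i.baseChange S) (p.baseChange S) := lTensor_exact S hip hp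
    have hp' : Function.Surjective (p.baseChange S) := LinearMap.lTensor_surjective S hp
    rw [ModuleCat.hasProjectiveDimensionLE_succ_iff hi' hip' hp'] at h
    rw [ModuleCat.hasProjectiveDimensionLE_succ_iff hi hip hp]
    exact ih _ h

lemma free_of_free_baseChange [Module.FaithfullyFlat R S] [IsLocalRing R] [IsNoetherianRing R]
    (N : Type u) [AddCommGroup N] [Module R N] [Module.Finite R N] [Module.Free S (S ⊗[R] N)] :
    Module.Free R N := by
  have : Module.Flat R N := Module.Flat.of_flat_tensorProduct R N S
  have : Module.FinitePresentation R N := Module.finitePresentation_of_finite R N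
  exact Module.free_of_flat_of_isLocalRing

end BaseChange

/-! ### Finite length of Tor -/

section FiniteLength

open TensorProduct IsLocalRing

variable {R : Type u} [CommRing R]

/-- Multiplication by `s` on `X` factors through a projective module. -/
def SMulFactorsThroughProjective (s : R) (X : Type u) [AddCommGroup X] [Module R X] : Prop :=
  ∃ (P : Type u) (_ : AddCommGroup P) (_ : Module R P) (_ : Module.Projective R P)
    (α : X →ₗ[R] P) (β : P →ₗ[R] X), β ∘ₗ α = s • LinearMap.id

/-- Lift `β` to `γ` through `p`. Then `s - γ α p` maps `F` into `K` and is `s` on `K`. Thus `s` on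
`K` factors through `F`, and the property passes to syzygies. -/
lemma SMulFactorsThroughProjective.exists_retraction {s : R} {X : Type u} [AddCommGroup X]
    [Module R X] (h : SMulFactorsThroughProjective s X) {K F : Type u} [AddCommGroup K]
    [Module R K] [AddCommGroup F] [Module R F] {i : K →ₗ[R] F} {p : F →ₗ[R] X}
    (hi : Function.Injective i) (hip : Function.Exact i p) (hp : Function.Surjective p) :
    ∃ ψ : F →ₗ[R] K, ψ ∘ₗ i = s • LinearMap.id := by
  obtain ⟨P, _, _, _, α, β, hβα⟩ := h
  obtain ⟨γ, hγ⟩ := Module.projective_lifting_property p β hp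
  have h1 : ∀ x, p ((s • LinearMap.id - γ ∘ₗ α ∘ₗ p : F →ₗ[R] F) x) = 0 := by
    intro x
    have h2 := LinearMap.congr_fun hγ (α (p x))
    have h3 := LinearMap.congr_fun hβα (p x)
    simp only [LinearMap.comp_apply, LinearMap.smul_apply, LinearMap.id_apply,
      LinearMap.sub_apply, map_sub, map_smul] at h2 h3 ⊢
    rw [h2, h3, sub_self]
  let e := LinearEquiv.ofInjective i hi
  refine ⟨e.symm.toLinearMap ∘ₗ (s • LinearMap.id - γ ∘ₗ α ∘ₗ p :
    F →ₗ[R] F).codRestrict (LinearMap.range i) (fun x => (hip _).1 (h1 x)), ?_⟩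
  ext k
  apply e.injective
  apply Subtype.ext
  simp only [e, LinearMap.comp_apply, LinearEquiv.coe_coe, LinearEquiv.apply_symm_apply, map_smul,
    LinearMap.smul_apply, LinearMap.id_apply]
  change s • i k - γ (α (p (i k))) = s • i k
  rw [hip.apply_apply_eq_zero, map_zero, map_zero, sub_zero]

lemma exists_finite_presentation [IsNoetherianRing R] (X : Type u) [AddCommGroup X] [Module R X]
    [Module.Finite R X] :
    ∃ (n : ℕ) (K : Type u) (_ : AddCommGroup K) (_ : Module R K) (_ : Module.Finite R K)
      (i : K →ₗ[R] (Fin n → R)) (p : (Fin n → R) →ₗ[R] X), Function.Injective i ∧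
        Function.Exact i p ∧ Function.Surjective p := by
  obtain ⟨n, p, hp⟩ := Module.Finite.exists_fin' R X
  exact ⟨n, LinearMap.ker p, Submodule.addCommGroup _, Submodule.module _, inferInstance,
    (LinearMap.ker p).subtype, p,
    Submodule.injective_subtype _, LinearMap.exact_subtype_ker_map p, hp⟩

lemma smul_torModule_eq_zero {s : R} (N : Type u) [AddCommGroup N] [Module R N] (k : ℕ) :
    ∀ (X : Type u) [AddCommGroup X] [Module R X], SMulFactorsThroughProjective s X →
      ∀ t : torModule R X N (k + 1), s • t = 0 := by
  induction k with
  | zero =>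
    intro X _ _ h t
    obtain ⟨K, F, _, _, _, _, _, i, p, hi, hip, hp⟩ := exists_projective_presentation (R := R) X
    obtain ⟨ψ, hψ⟩ := h.exists_retraction hi hip hp
    obtain ⟨e⟩ := nonempty_torModule_one_equiv hi hip hp N
    apply e.injective
    apply Subtype.ext
    have h1 : ψ.rTensor N (i.rTensor N (e t).1) = s • (e t).1 := by
      rw [← LinearMap.comp_apply, ← LinearMap.rTensor_comp, hψ, LinearMap.rTensor_smul]
      simp
    have h2 : i.rTensor N (e t).1 = 0 := (e t).2
    rw [h2, map_zero] at h1
    rw [map_smul, map_zero]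
    exact h1.symm
  | succ k ih =>
    intro X _ _ h t
    obtain ⟨K, F, _, _, _, _, _, i, p, hi, hip, hp⟩ := exists_projective_presentation (R := R) X
    obtain ⟨ψ, hψ⟩ := h.exists_retraction hi hip hp
    obtain ⟨e⟩ := nonempty_torModule_equiv hi hip hp N k
    apply e.injective
    rw [map_smul, map_zero]
    exact ih _ ⟨F, _, _, inferInstance, i, ψ, hψ⟩ _

lemma finite_torModule [IsNoetherianRing R] (N : Type u) [AddCommGroup N] [Module R N]
    [Module.Finite R N] (k : ℕ) : ∀ (X : Type u) [AddCommGroup X] [Module R X]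
      [Module.Finite R X], Module.Finite R (torModule R X N (k + 1)) := by
  induction k with
  | zero =>
    intro X _ _ _
    obtain ⟨n, K, _, _, _, i, p, hi, hip, hp⟩ := exists_finite_presentation (R := R) X
    obtain ⟨e⟩ := nonempty_torModule_one_equiv hi hip hp N
    exact Module.Finite.equiv e.symm
  | succ k ih =>
    intro X _ _ _
    obtain ⟨n, K, _, _, _, i, p, hi, hip, hp⟩ := exists_finite_presentation (R := R) X
    obtain ⟨e⟩ := nonempty_torModule_equiv hi hip hp N k
    have := ih K
    exact Module.Finite.equiv e.symm

/-- If `M_p` is free, some `s ∉ p` acts on `M` through a free module. -/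
lemma exists_comp_eq_smul_of_free_localizedModule [IsNoetherianRing R] (M : Type u)
    [AddCommGroup M] [Module R M] [Module.Finite R M] (p : Ideal R) [p.IsPrime]
    (h : Module.Free (Localization.AtPrime p) (LocalizedModule p.primeCompl M)) :
    ∃ s ∉ p, ∃ (k : ℕ) (α : M →ₗ[R] (Fin k → R)) (β : (Fin k → R) →ₗ[R] M),
      β ∘ₗ α = s • LinearMap.id := by
  have hfp : Module.FinitePresentation R M := Module.finitePresentation_of_finite R M
  let b := Module.finBasis (Localization.AtPrime p) (LocalizedModule p.primeCompl M)
  let k := Module.finrank (Localization.AtPrime p) (LocalizedModule p.primeCompl M)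
  let e : LocalizedModule p.primeCompl M ≃ₗ[R] (Fin k → Localization.AtPrime p) :=
    b.equivFun.restrictScalars R
  let ι : (Fin k → R) →ₗ[R] (Fin k → Localization.AtPrime p) :=
    .pi fun i => Algebra.linearMap R (Localization.AtPrime p) ∘ₗ LinearMap.proj i
  let mk := LocalizedModule.mkLinearMap p.primeCompl M
  -- `s₁` and `s₂` clear the denominators of the two inverse isomorphisms; `s₃` turns the identity
  -- between their lifts, valid only after localization, into one over `R`.
  obtain ⟨α, s₁, hα⟩ := Module.FinitePresentation.exists_lift_of_isLocalizedModule p.primeCompl ι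
    (e.toLinearMap ∘ₗ mk)
  obtain ⟨β, s₂, hβ⟩ := Module.FinitePresentation.exists_lift_of_isLocalizedModule p.primeCompl mk
    (e.symm.toLinearMap ∘ₗ ι)
  obtain ⟨s₃, hs⟩ := Module.Finite.exists_smul_of_comp_eq_of_isLocalizedModule p.primeCompl mk
    (β ∘ₗ α) ((s₂ * s₁) • LinearMap.id) (by
      ext x
      have h1 := LinearMap.congr_fun hβ (α x)
      have h2 := LinearMap.congr_fun hα x
      simp only [LinearMap.comp_apply, LinearMap.smul_apply, LinearEquiv.coe_coe] at h1 h2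
      simp only [LinearMap.comp_apply, LinearMap.smul_apply, LinearMap.id_apply]
      rw [h1, h2, Submonoid.smul_def, Submonoid.smul_def, Submonoid.smul_def, map_smul, map_smul,
        e.symm_apply_apply, Submonoid.coe_mul, mul_smul])
  exact ⟨(s₃ * (s₂ * s₁) : p.primeCompl), (s₃ * (s₂ * s₁) : p.primeCompl).2, k, α,
    (s₃ : R) • β, by
      ext x
      have := LinearMap.congr_fun hs x
      simpa [Submonoid.smul_def, mul_smul] using this⟩

/-- The hypothesis leaves `𝔪` as the only prime containing the annihilator, so the quotient by the
annihilator is Artinian. -/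
lemma length_ne_top_of_forall_prime [IsLocalRing R] [IsNoetherianRing R] (L : Type u)
    [AddCommGroup L] [Module R L] [Module.Finite R L]
    (h : ∀ p : Ideal R, p.IsPrime → p ≠ maximalIdeal R → ∃ s ∉ p, ∀ x : L, s • x = 0) :
    Module.length R L ≠ ⊤ := by
  let I := Module.annihilator R L
  have hart : IsArtinianRing (R ⧸ I) := by
    rw [isArtinianRing_iff_krullDimLE_zero, Ring.krullDimLE_zero_iff]
    intro P hP
    have hc : P.comap (Ideal.Quotient.mk I) = maximalIdeal R := by
      by_contra hne
      obtain ⟨s, hs, hs'⟩ := h _ inferInstance hne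
      apply hs
      rw [Ideal.mem_comap, Ideal.Quotient.eq_zero_iff_mem.2 (Module.mem_annihilator.2 hs')]
      exact P.zero_mem
    have hmax : (P.comap (Ideal.Quotient.mk I)).IsMaximal := by rw [hc]; infer_instance
    rw [← Ideal.map_comap_of_surjective _ Ideal.Quotient.mk_surjective P]
    exact (Ideal.map_eq_top_or_isMaximal_of_surjective _ Ideal.Quotient.mk_surjective
      hmax).resolve_left (by
        rw [Ideal.map_comap_of_surjective _ Ideal.Quotient.mk_surjective P]; exact hP.ne_top)
  let _ : Module (R ⧸ I) L := (Module.isTorsionBySet_annihilator R L).module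
  have : IsScalarTower R (R ⧸ I) L := (Module.isTorsionBySet_annihilator R L).isScalarTower
  have : Module.Finite (R ⧸ I) L := Module.Finite.of_restrictScalars_finite R _ L
  have : IsArtinian R L := isArtinian_of_surjective_algebraMap (M := L)
    (Ideal.Quotient.mk_surjective (I := I))
  exact Module.length_ne_top

/-- For `M` locally free on the punctured spectrum, `Tor_{k+1}(M*, N)` has finite length. -/
lemma length_torModule_dual_ne_top [IsLocalRing R] [IsNoetherianRing R] (M N : Type u)
    [AddCommGroup M] [Module R M] [Module.Finite R M] [AddCommGroup N] [Module R N]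
    [Module.Finite R N] (hM : IsLocallyFreeOnPuncturedSpectrum R M) (k : ℕ) :
    Module.length R (torModule R (Module.Dual R M) N (k + 1)) ≠ ⊤ := by
  have := finite_torModule (R := R) N k (Module.Dual R M)
  refine length_ne_top_of_forall_prime _ fun p hp hpm => ?_
  obtain ⟨s, hs, n, α, β, hβα⟩ := exists_comp_eq_smul_of_free_localizedModule M p
    (hM ⟨p, hp⟩ fun h => hpm (congrArg PrimeSpectrum.asIdeal h))
  refine ⟨s, hs, smul_torModule_eq_zero N k _
    ⟨Module.Dual R (Fin n → R), _, _, inferInstance, β.dualMap, α.dualMap, ?_⟩⟩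
  ext l x
  have := LinearMap.congr_fun hβα x
  simp only [LinearMap.comp_apply, LinearMap.smul_apply, LinearMap.id_apply,
    LinearMap.dualMap_apply] at this ⊢
  rw [this, map_smul]

end FiniteLength

/-! ### The argument over a faithfully flat hypersurface -/

section Main

open TensorProduct IsLocalRing

lemma subsingleton_torModule_congr {A : Type u} [CommRing A] {X Y : Type u} [AddCommGroup X]
    [Module A X] [AddCommGroup Y] [Module A Y] (e : X ≃ₗ[A] Y) (N : Type u) [AddCommGroup N]
    [Module A N] (k : ℕ) : Subsingleton (torModule A X N k) ↔ Subsingleton (torModule A Y N k) :=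
  (((Tor' (ModuleCat.{u} A) k).mapIso e.toModuleIso).app
    (ModuleCat.of A N)).toLinearEquiv.toEquiv.subsingleton_congr

/-- Killing the sequence raises the projective dimension by its length, at least `dim T - 1`, and
the result is at most `dim T`. -/
lemma hasProjectiveDimensionLE_one_of_isWeaklyRegular {T : Type u} [CommRing T]
    [IsRegularLocalRing T] (X : Type u) [AddCommGroup X] [Module T X] [Module.Finite T X]
    [Nontrivial X] (rs : List T) (hrs : RingTheory.Sequence.IsWeaklyRegular X rs)
    (hmem : ∀ r ∈ rs, r ∈ maximalIdeal T)
    (hT : ringKrullDim T ≤ ((rs.length + 1 : ℕ) : WithBot ℕ∞)) :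
    HasProjectiveDimensionLE (ModuleCat.of T X) 1 := by
  obtain ⟨d, hd⟩ := IsRegularLocalRing.exists_krullDim_eq T
  have h1 := ModuleCat.projectiveDimension_quotient_eq_add_length_of_isWeaklyRegular (ModuleCat.of T X) rs
    hrs hmem
  have h2 := IsRegularLocalRing.hasProjectiveDimensionLE d T hd
    (X ⧸ Ideal.ofList rs • (⊤ : Submodule T X))
  rw [← projectiveDimension_le_iff] at h2 ⊢
  have h3 : projectiveDimension (ModuleCat.of T X) + rs.length ≤
      ((1 : ℕ) : WithBot ℕ∞) + rs.length := by
    refine (h1.symm.le.trans h2).trans ((hd.symm.le.trans hT).trans ?_)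
    push_cast
    rw [add_comm]
  exact (ENat.WithBot.add_le_add_natCast_right_iff).1 h3

variable {T S : Type u} [CommRing T] [CommRing S] [Algebra T S] {f : T}

lemma Matrix.actExact_self [IsDomain T] (hf : f ≠ 0)
    (hker : ∀ t, algebraMap T S t = 0 ↔ ∃ a, t = f * a)
    (hsurj : Function.Surjective (algebraMap T S)) {n : ℕ} {C D : Matrix (Fin n) (Fin n) T}
    (hCD : C * D = f • 1) :
    (C.map (algebraMap T S)).ActExact (D.map (algebraMap T S)) S := by
  rw [Matrix.actExact_map_iff]
  intro y hy
  obtain ⟨z, hz⟩ := actExact_pi hf hker hsurj hCD 1 (fun i _ => y i) (by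
    ext j _
    simpa [Matrix.act_apply] using congrFun hy j)
  refine ⟨fun i => z i 0, ?_⟩
  ext j
  simpa [Matrix.act_apply] using congrFun (congrFun hz j) 0

lemma act_map_act_map_eq_zero (hfS : algebraMap T S f = 0) {n : ℕ}
    {C D : Matrix (Fin n) (Fin n) T} (hCD : C * D = f • 1) (y : Fin n → S) :
    (C.map (algebraMap T S)).act S ((D.map (algebraMap T S)).act S y) = 0 := by
  rw [Matrix.act_map, Matrix.act_map, Matrix.act_act, hCD, Matrix.act_smul_one]
  exact smul_eq_zero_of_algebraMap_eq_zero hfS y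

/-- Let `R → S = T / (f)` be a faithfully flat local homomorphism with `T` regular local, and let
`M` have depth at least `dim T - 1`. If `Ext¹(M, N) = 0` and the vanishing of some even
`Tor(M*, N)` implies that of the preceding odd one, then `M` is free or `N` has finite projective
dimension. -/
theorem free_or_exists_hasProjectiveDimensionLE [IsRegularLocalRing T]
    (hker : ∀ t, algebraMap T S t = 0 ↔ ∃ a, t = f * a)
    (hsurj : Function.Surjective (algebraMap T S))
    {R : Type u} [CommRing R] [IsLocalRing R] [IsNoetherianRing R] [Algebra R S]
    [Module.FaithfullyFlat R S] [IsLocalHom (algebraMap R S)]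
    (M N : Type u) [AddCommGroup M] [Module R M] [Module.Finite R M] [AddCommGroup N] [Module R N]
    [Module.Finite R N] (rs : List R) (hrs : RingTheory.Sequence.IsWeaklyRegular M rs)
    (hmem : ∀ r ∈ rs, r ∈ maximalIdeal R)
    (hT : ringKrullDim T ≤ ((rs.length + 1 : ℕ) : WithBot ℕ∞)) (e : ℕ)
    (hTor : Subsingleton (torModule R (Module.Dual R M) N (2 * e + 2)) →
      Subsingleton (torModule R (Module.Dual R M) N (2 * e + 1)))
    (hExt : Subsingleton (Abelian.Ext (ModuleCat.of R M) (ModuleCat.of R N) 1)) :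
    Module.Free R M ∨ ∃ d : ℕ, HasProjectiveDimensionLE (ModuleCat.of R N) d := by
  have hdom := IsRegularLocalRing.isDomain T
  have hfS : algebraMap T S f = 0 := (hker f).2 ⟨1, by simp⟩
  have hTS : Module.Finite T S := .of_surjective (Algebra.linearMap T S) hsurj
  obtain ⟨d, hd⟩ := IsRegularLocalRing.exists_krullDim_eq T
  rcases eq_or_ne f 0 with hf | hf
  · have hbij : Function.Bijective (algebraMap T S) := by
      refine ⟨(injective_iff_map_eq_zero _).2 fun t ht => ?_, hsurj⟩
      obtain ⟨a, rfl⟩ := (hker t).1 ht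
      rw [hf, zero_mul]
    let E : T ≃+* S := RingEquiv.ofBijective (algebraMap T S) hbij
    have := IsRegularLocalRing.of_ringEquiv E
    exact .inr ⟨d, hasProjectiveDimensionLE_of_baseChange S d N
      (IsRegularLocalRing.hasProjectiveDimensionLE d S
        ((ringKrullDim_eq_of_ringEquiv E).symm.trans hd) _)⟩
  rcases subsingleton_or_nontrivial M with hM0 | hM0
  · exact .inl inferInstance
  have : Module.Finite T (S ⊗[R] M) := .trans S _
  have : Module.Finite T (S ⊗[R] N) := .trans S _
  have : Nontrivial (S ⊗[R] M) :=
    (Module.FaithfullyFlat.nontrivial_tensorProduct_iff_right R S).2 hM0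
  -- The regular sequence survives flat base change; its lifts to `T` act in the same way.
  have hpd : HasProjectiveDimensionLE (ModuleCat.of T (S ⊗[R] M)) 1 := by
    choose g hg using fun r : R => hsurj (algebraMap R S r)
    refine hasProjectiveDimensionLE_one_of_isWeaklyRegular _ (rs.map g) ?_ ?_
      (by rwa [List.length_map])
    · rw [← RingTheory.Sequence.isWeaklyRegular_map_algebraMap_iff (R := T) (S := S),
        List.map_map]
      have : algebraMap T S ∘ g = algebraMap R S := funext hg
      rw [this]
      exact hrs.of_flat_of_isBaseChange (TensorProduct.isBaseChange R M S)
    · intro t ht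
      obtain ⟨r, hr, rfl⟩ := List.mem_map.1 ht
      rw [mem_maximalIdeal, mem_nonunits_iff]
      intro hu
      have h1 := hu.map (algebraMap T S)
      rw [hg] at h1
      exact (mem_maximalIdeal r).1 (hmem r hr) ((isUnit_map_iff (algebraMap R S) r).1 h1)
  obtain ⟨n, q, A, B, hq, hqA, hAB, hBA, hA⟩ := exists_minimal_matrixFactorization hf (S ⊗[R] M)
    (smul_eq_zero_of_algebraMap_eq_zero hfS) hpd
  have hCD : A.transpose * B.transpose = f • 1 := by
    rw [← Matrix.transpose_mul, hBA, Matrix.transpose_smul, Matrix.transpose_one]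
  have hDC : B.transpose * A.transpose = f • 1 := by
    rw [← Matrix.transpose_mul, hAB, Matrix.transpose_smul, Matrix.transpose_one]
  obtain ⟨g, hg, hgA⟩ := exists_linearMap_exact_map hsurj hq hqA
  have hex : A.transpose.ActExact B.transpose (S ⊗[R] N) := by
    rw [← Matrix.actExact_map_iff (B := S)]
    exact Matrix.ActExact.of_subsingleton_ext hg hgA
      (Matrix.actExact_self hf hker hsurj hBA) _ (subsingleton_ext_one_baseChange S M N hExt)
  have hfp : Module.FinitePresentation R M := Module.finitePresentation_of_finite R M
  obtain ⟨E₁⟩ := nonempty_dual_baseChange_equiv (R := R) S M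
  obtain ⟨E₂⟩ := nonempty_dual_equiv_of_exact hg hgA
    (act_map_act_map_eq_zero hfS hCD) (Matrix.actExact_self hf hker hsurj hDC)
  have key := subsingleton_torModule_range (act_map_act_map_eq_zero hfS hDC)
    (act_map_act_map_eq_zero hfS hCD) (Matrix.actExact_self hf hker hsurj hCD)
    (Matrix.actExact_self hf hker hsurj hDC) (S ⊗[R] N) e
  have hbc : ∀ k, Subsingleton (torModule R (Module.Dual R M) N (k + 1)) ↔
      Subsingleton (torModule S (LinearMap.range
        ((B.transpose.map (algebraMap T S)).act S)) (S ⊗[R] N) (k + 1)) := fun k =>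
    (subsingleton_torModule_baseChange_iff S N k (Module.Dual R M)).symm.trans
      (subsingleton_torModule_congr (E₁ ≪≫ₗ E₂) _ _)
  rw [← hbc, ← hbc, Matrix.actExact_map_iff, Matrix.actExact_map_iff] at key
  -- `Ext¹ = 0` gave exactness at the spot computing even Tor; `hTor` transfers vanishing to odd
  -- Tor, the other spot.
  have hex' := key.1.1 (hTor (key.2.2 hex))
  by_cases hB : IsUnit B.det
  · left
    have : Module.Free S (S ⊗[R] M) := free_of_isUnit_det hfS hsurj hq hqA hAB hB
    exact free_of_free_baseChange S M
  · right
    have := IsRegularLocalRing.hasProjectiveDimensionLE d T hd (S ⊗[R] N)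
    obtain ⟨c, hc⟩ := exists_hasProjectiveDimensionLE_of_actExact hf hker hsurj hCD hDC
      (fun i j => hA j i) (by rwa [Matrix.det_transpose]) d (S ⊗[R] N)
      (hasProjectiveDimensionLT_of_ge _ (d + 1) (d + 2) (by omega)) hex hex'
    exact ⟨c, hasProjectiveDimensionLE_of_baseChange S c N hc⟩

end Main

/-! ### Dimension of the completion, depth, and the conclusion -/

section Completion

open IsLocalRing

/-- The extension of `𝔪` is the maximal ideal of the completion, so the closed fibre contributes
height zero. -/
lemma ringKrullDim_adicCompletion_le (R : Type u) [CommRing R] [IsLocalRing R]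
    [IsNoetherianRing R] [IsNoetherianRing (AdicCompletion (maximalIdeal R) R)] :
    ringKrullDim (AdicCompletion (maximalIdeal R) R) ≤ ringKrullDim R := by
  rw [← maximalIdeal_height_eq_ringKrullDim, ← maximalIdeal_height_eq_ringKrullDim]
  have hloc : IsLocalHom (algebraMap R (AdicCompletion (maximalIdeal R) R)) := inferInstance
  have hcomap := ((local_hom_TFAE
    (algebraMap R (AdicCompletion (maximalIdeal R) R))).out 0 4).1 hloc
  have : (maximalIdeal (AdicCompletion (maximalIdeal R) R)).LiesOver (maximalIdeal R) :=
    ⟨hcomap.symm⟩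
  have h := Ideal.height_le_height_add_of_liesOver (maximalIdeal R)
    (maximalIdeal (AdicCompletion (maximalIdeal R) R))
  have h0 : (maximalIdeal (AdicCompletion (maximalIdeal R) R)).map (Ideal.Quotient.mk
      ((maximalIdeal R).map (algebraMap R (AdicCompletion (maximalIdeal R) R)))) = ⊥ := by
    rw [AdicCompletion.maximalIdeal_eq_map]
    exact Ideal.map_quotient_self _
  have h1 : Nontrivial (AdicCompletion (maximalIdeal R) R ⧸
      (maximalIdeal R).map (algebraMap R (AdicCompletion (maximalIdeal R) R))) := by
    rw [← AdicCompletion.maximalIdeal_eq_map]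
    infer_instance
  rw [h0, Ideal.height_bot, add_zero] at h
  exact_mod_cast h

/-- A finite depth `n` is attained by a weakly regular sequence. -/
lemma exists_isWeaklyRegular_of_moduleDepth_eq {R : Type u} [CommRing R] [IsLocalRing R]
    {M : Type v} [AddCommGroup M] [Module R M] {n : ℕ} (h : moduleDepth R M = n) :
    ∃ rs : List R, (∀ r ∈ rs, r ∈ maximalIdeal R) ∧
      RingTheory.Sequence.IsWeaklyRegular M rs ∧ n ≤ rs.length := by
  by_contra! hcon
  rcases n with _ | n
  · exact absurd (hcon [] (by simp) (by simp)) (by simp)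
  · have : moduleDepth R M ≤ n := iSup_le fun rs => iSup_le fun h1 => iSup_le fun h2 =>
      Nat.cast_le.2 (Nat.lt_succ_iff.1 (hcon rs h1 h2))
    rw [h, Nat.cast_le] at this
    omega

end Completion

theorem mainTheorem6 (R : Type u) [CommRing R] [IsLocalRing R] [IsNoetherianRing R]
    (hR : IsLocalHypersurface R) (hdim : ringKrullDim R = 3)
    (M : Type u) [AddCommGroup M] [Module R M]
    (hM : IsMaximalCohenMacaulay R M) (hMfree : IsLocallyFreeOnPuncturedSpectrum R M)
    (N : Type u) [AddCommGroup N] [Module R N] [Module.Finite R N]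
    (e : ℕ) (he : ringKrullDim R ≤ ((2 * e : ℕ) : WithBot ℕ∞))
    (hθ : hochsterTheta R (Module.Dual R M) N e = 0)
    (hExt : Subsingleton (Abelian.Ext (ModuleCat.of R M) (ModuleCat.of R N) 1)) :
    Module.Free R M ∨ projectiveDimension (ModuleCat.of R N) < ⊤ := by
  obtain ⟨T, _, _, f, ⟨E⟩⟩ := hR
  have := hM.finite
  have hnoeth : IsNoetherianRing (AdicCompletion (IsLocalRing.maximalIdeal R) R) :=
    isNoetherianRing_of_ringEquiv _ E.symm
  let φ : R →+* T ⧸ Ideal.span {f} :=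
    E.toRingHom.comp (algebraMap R (AdicCompletion (IsLocalRing.maximalIdeal R) R))
  let _ : Algebra R (T ⧸ Ideal.span {f}) := φ.toAlgebra
  let E' : AdicCompletion (IsLocalRing.maximalIdeal R) R ≃ₐ[R] T ⧸ Ideal.span {f} :=
    AlgEquiv.ofRingEquiv (f := E) fun _ => rfl
  have hff : Module.FaithfullyFlat R (AdicCompletion (IsLocalRing.maximalIdeal R) R) :=
    .of_flat_of_isLocalHom
  have : Module.FaithfullyFlat R (T ⧸ Ideal.span {f}) := .of_linearEquiv _ _ E'.toLinearEquiv.symm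
  have : IsLocalHom (algebraMap R (T ⧸ Ideal.span {f})) := by
    refine ⟨fun a ha => ?_⟩
    have h1 : IsUnit (E (algebraMap R (AdicCompletion (IsLocalRing.maximalIdeal R) R) a)) := ha
    rw [isUnit_map_iff] at h1
    exact isUnit_of_map_unit _ _ h1
  have hdepth : moduleDepth R M = (3 : ℕ) :=
    WithBot.coe_injective (hM.depth_eq.trans hdim)
  obtain ⟨rs, hmem, hrs, hlen⟩ := exists_isWeaklyRegular_of_moduleDepth_eq hdepth
  -- Factoring out `f` lowers the dimension by at most one, so `dim T ≤ 3 + 1`. A unit `f` would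
  -- make the completion zero.
  have hT : ringKrullDim T ≤ ((rs.length + 1 : ℕ) : WithBot ℕ∞) := by
    by_cases hf : f ∈ IsLocalRing.maximalIdeal T
    · have h1 := ringKrullDim_le_ringKrullDim_quotient_add_card ({f} : Finset T) (by
        rw [IsLocalRing.ringJacobson_eq_maximalIdeal]
        simpa using hf)
      rw [Finset.coe_singleton, Finset.card_singleton, ← ringKrullDim_eq_of_ringEquiv E] at h1
      refine h1.trans ?_
      have h2 := (ringKrullDim_adicCompletion_le R).trans hdim.le
      refine (add_le_add_left h2 _).trans ?_
      have h3 : 3 + 1 ≤ rs.length + 1 := by omega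
      exact_mod_cast h3
    · rw [IsLocalRing.mem_maximalIdeal, mem_nonunits_iff, not_not] at hf
      have h1 : Subsingleton (T ⧸ Ideal.span {f}) :=
        Ideal.Quotient.subsingleton_iff.2 (Ideal.span_singleton_eq_top.2 hf)
      exact absurd h1 (not_subsingleton_iff_nontrivial.2 E.symm.toEquiv.nontrivial)
  have hlengths := length_torModule_dual_ne_top M N hMfree
  rcases free_or_exists_hasProjectiveDimensionLE (T := T) (S := T ⧸ Ideal.span {f}) (f := f)
    (fun t => by
      rw [Ideal.Quotient.algebraMap_eq, Ideal.Quotient.eq_zero_iff_mem,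
        Ideal.mem_span_singleton]
      rfl) Ideal.Quotient.mk_surjective M N rs hrs hmem hT e (fun h => by
      have h1 : Module.length R (torModule R (Module.Dual R M) N (2 * e + 2)) = 0 :=
        Module.length_eq_zero_iff.2 h
      rw [hochsterTheta, h1] at hθ
      -- `toNat` also sends `⊤` to 0, so finiteness of the length is what turns this into vanishing
      -- of Tor.
      have h2 : (Module.length R (torModule R (Module.Dual R M) N (2 * e + 1))).toNat = 0 := by
        simpa using hθ
      exact Module.length_eq_zero_iff.1
        ((ENat.toNat_eq_zero.1 h2).resolve_right (hlengths (2 * e)))) hExt with h | ⟨d, hd⟩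
  · exact .inl h
  · right
    exact ((projectiveDimension_le_iff _ _).2 hd).trans_lt (WithBot.coe_lt_coe.2 (ENat.natCast_lt_top d))
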